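/- Let $\mathcal C$ be a proper model category, with classes $I$ of fibrations and $J$ of acyclic fibrations (fibrations that are weak equivalences). Let $\mathrm{pro}\text{-}\mathcal C$ be the category of pro-objects of $\mathcal C$: objects are the diagrams in $\mathcal C$ indexed by small cofiltered categories, and $\mathrm{Hom}(X,Y)=\lim_s\operatorname{colim}_t\mathrm{Hom}_{\mathcal C}(X_t,Y_s)$. Let $c:\mathcal C\to\mathrm{pro}\text{-}\mathcal C$ be the constant pro-object functor, and let $cI$, $cJ$ be the images of $I$, $J$ under $c$. A level representation of a map $f$ of $\mathrm{pro}\text{-}\mathcal C$ is a natural transformation $p$ between two diagrams in $\mathcal C$ indexed by the same small cofiltered category, together with an isomorphism between $f$ and the map of pro-objects represented by $p$. A strict weak equivalence is a map having a level representation $p$ in which every $p_s$ is a weak equivalence. A level representation is cofinite directed if it is indexed by a nonempty directed partially ordered set in which every element has only finitely many elements below it; its relative matching maps are then $$M_tp:X_t\to \lim_{s<t}X_s\times_{\lim_{s<t}Y_s}Y_t .$$ A special fibration is a map having a cofinite directed level representation $p$ with every $M_tp$ a fibration. A strict fibration is a retract of a special fibration, and a strict acyclic fibration is a strict fibration that is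 also a strict weak equivalence. For a class $K$ of maps of a category, a map is a $K$-cocell complex if it is isomorphic to the projection $\lim_{\beta<\lambda}Z_\beta\to Z_0$ for some (nonzero) ordinal $\lambda$ and some tower $\cdots\to Z_\beta\to\cdots\to Z_1\to Z_0$ of length $\lambda$ such that $Z_\beta=\lim_{\alpha<\beta}Z_\alpha$ for every limit ordinal $\beta<\lambda$ and every $Z_{\beta+1}\to Z_\beta$ with $\beta+1<\lambda$ is a base change of a map in $K$. Then the class of strict fibrations of $\mathrm{pro}\text{-}\mathcal C$ is equal to the class of retracts of $cI$-cocell complexes, and the class of strict acyclic fibrations of $\mathrm{pro}\text{-}\mathcal C$ is equal to the class of retracts of $cJ$-cocell complexes. -/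

import Mathlib

open CategoryTheory Limits HomotopicalAlgebra

universe w v u

namespace StrictPro

/-! ### Proper model categories -/

/-- A model category is proper if weak equivalences are stable under base change along
fibrations (right properness) and under cobase change along cofibrations (left properness). -/
class IsProperModelCategory (C : Type u) [Category.{v} C] [ModelCategory C] : Prop where
  right_proper {A B X Y : C} {f : A ⟶ X} {g : A ⟶ B} {p : X ⟶ Y} {q : B ⟶ Y}
    (sq : IsPullback f g p q) (hp : fibrations C p) (hq : weakEquivalences C q) :
    weakEquivalences C f
  left_proper {A B X Y : C} {f : A ⟶ X} {g : A ⟶ B} {p : X ⟶ Y} {q : B ⟶ Y}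
    (sq : IsPushout f g p q) (hg : cofibrations C g) (hf : weakEquivalences C f) :
    weakEquivalences C q

section Pro

variable (C : Type u) [Category.{v} C]

/-! ### Pro-objects -/

/-- The category of pro-objects of `C`, i.e. of formal limits of small cofiltered diagrams in `C`:
the opposite of the category of ind-objects of `Cᵒᵖ`. Its objects are, up to isomorphism, the small
cofiltered diagrams in `C`, and the maps from the pro-object represented by `X : I ⥤ C` to the one
represented by `Y : J ⥤ C` are `lim_{s : J} colim_{t : I} Hom(X_t, Y_s)`. -/
abbrev Pro : Type (max u (v + 1)) := (Ind Cᵒᵖ)ᵒᵖ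

/-- The functor `c : C ⥤ Pro C` sending an object to the constant pro-object on it. -/
noncomputable def Pro.const : C ⥤ Pro C := (Ind.yoneda (C := Cᵒᵖ)).rightOp

variable {C}

/-- The functor sending a small cofiltered diagram `X : I ⥤ C` to the pro-object which it
represents, and a natural transformation to the map of pro-objects which it represents. -/
noncomputable def Pro.ofDiagram (I : Type v) [SmallCategory I] [IsCofiltered I] :
    (I ⥤ C) ⥤ Pro C :=
  (Functor.opHom I C ⋙ Ind.lim Iᵒᵖ).rightOp

/-- A level representation of a map `f` of pro-objects, indexed by the small cofiltered
category `I`: a natural transformation of `I`-indexed diagrams in `C` together with an isomorphism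
in the arrow category of `Pro C` from `f` to the map of pro-objects that it represents. -/
structure LevelRep (I : Type v) [SmallCategory I] [IsCofiltered I] {X Y : Pro C} (f : X ⟶ Y) where
  /-- the diagram representing the source -/
  src : I ⥤ C
  /-- the diagram representing the target -/
  tgt : I ⥤ C
  /-- the levelwise maps -/
  map : src ⟶ tgt
  /-- the identification of `f` with the map of pro-objects represented by `map` -/
  iso : Arrow.mk f ≅ Arrow.mk ((Pro.ofDiagram I).map map)

/-- The maps of pro-objects which belong to `P` essentially levelwise: those having a level
representation `p` all of whose components `p_s` belong to `P`. -/
def essentiallyLevelwise (P : MorphismProperty C) : MorphismProperty (Pro C) := fun _ _ f =>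
  ∃ (I : Type v) (_ : SmallCategory I) (_ : IsCofiltered I) (p : LevelRep I f),
    ∀ s : I, P (p.map.app s)

end Pro

/-! ### Relative matching maps -/

/-- A cofinite directed set: a nonempty partially ordered set in which any two elements have an
upper bound, and such that every element has only finitely many elements below it. -/
class IsCofiniteDirected (I : Type w) [PartialOrder I] : Prop where
  nonempty : Nonempty I
  directed (s t : I) : ∃ u : I, s ≤ u ∧ t ≤ u
  finite_le (t : I) : (Set.Iic t).Finite

section Matching

variable {I : Type w} [PartialOrder I]

instance [IsCofiniteDirected I] : IsFiltered I :=
  have : Nonempty I := IsCofiniteDirected.nonempty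
  have : IsDirectedOrder I := ⟨IsCofiniteDirected.directed⟩
  inferInstance

instance [IsCofiniteDirected I] (t : I) : Finite (Set.Iio t) :=
  (IsCofiniteDirected.finite_le t).subset Set.Iio_subset_Iic_self

variable {C : Type u} [Category.{v} C]

instance [IsCofiniteDirected I] [HasFiniteLimits C] (t : I) :
    HasLimitsOfShape (Set.Iio t)ᵒᵖ C := by
  let _ : Fintype (Set.Iio t) := Fintype.ofFinite _
  infer_instance

/-- The inclusion of the set of all `s < t` into `I`, as a functor. -/
abbrev belowIncl (t : I) : Set.Iio t ⥤ I where
  obj s := s.1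
  map g := homOfLE (leOfHom g)

/-- The restriction of a diagram `X`, given by maps `X_t ⟶ X_s` for `s ≤ t` in `I`, to the
set of all `s < t`. -/
abbrev below (X : Iᵒᵖ ⥤ C) (t : I) : (Set.Iio t)ᵒᵖ ⥤ C :=
  (belowIncl t).op ⋙ X

/-- The cone formed by the maps `X_t ⟶ X_s` for `s < t`. -/
def belowCone (X : Iᵒᵖ ⥤ C) (t : I) : Cone (below X t) where
  pt := X.obj (Opposite.op t)
  π :=
    { app s := X.map (homOfLE (le_of_lt s.unop.2)).op
      naturality s s' g := by
        exact (Category.id_comp _).trans (X.map_comp _ _) }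

variable [IsCofiniteDirected I] [HasFiniteLimits C]

/-- The map `X_t ⟶ lim_{s < t} X_s`. -/
noncomputable def toMatching (X : Iᵒᵖ ⥤ C) (t : I) :
    X.obj (Opposite.op t) ⟶ limit (below X t) :=
  limit.lift (below X t) (belowCone X t)

/-- The map `lim_{s < t} X_s ⟶ lim_{s < t} Y_s` induced by `p : X ⟶ Y`. -/
noncomputable def matchingMap {X Y : Iᵒᵖ ⥤ C} (p : X ⟶ Y) (t : I) :
    limit (below X t) ⟶ limit (below Y t) :=
  limMap (Functor.whiskerLeft (belowIncl t).op p)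

lemma toMatching_π (X : Iᵒᵖ ⥤ C) (t : I) (s : (Set.Iio t)ᵒᵖ) :
    toMatching X t ≫ limit.π (below X t) s = (belowCone X t).π.app s :=
  limit.lift_π (belowCone X t) s

lemma matchingMap_π {X Y : Iᵒᵖ ⥤ C} (p : X ⟶ Y) (t : I) (s : (Set.Iio t)ᵒᵖ) :
    matchingMap p t ≫ limit.π (below Y t) s =
      limit.π (below X t) s ≫ (Functor.whiskerLeft (belowIncl t).op p).app s :=
  limMap_π _ s

lemma toMatching_naturality {X Y : Iᵒᵖ ⥤ C} (p : X ⟶ Y) (t : I) :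
    toMatching X t ≫ matchingMap p t = p.app (Opposite.op t) ≫ toMatching Y t := by
  apply limit.hom_ext
  intro s
  rw [Category.assoc, matchingMap_π, ← Category.assoc, toMatching_π, Category.assoc, toMatching_π]
  exact p.naturality _

/-- The relative matching map
`M_t p : X_t ⟶ lim_{s < t} X_s ×_{lim_{s < t} Y_s} Y_t` of `p : X ⟶ Y`. -/
noncomputable def relMatchingMap {X Y : Iᵒᵖ ⥤ C} (p : X ⟶ Y) (t : I) :
    X.obj (Opposite.op t) ⟶ pullback (matchingMap p t) (toMatching Y t) :=
  pullback.lift (toMatching X t) (p.app (Opposite.op t)) (toMatching_naturality p t)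

end Matching

/-! ### Strict weak equivalences and strict fibrations -/

section Strict

variable {C : Type u} [Category.{v} C]

/-- The maps of pro-objects having a cofinite directed level representation all of whose relative
matching maps belong to `P`. -/
def special [HasFiniteLimits C] (P : MorphismProperty C) : MorphismProperty (Pro C) := fun _ _ f =>
  ∃ (I : Type v) (_ : PartialOrder I) (_ : IsCofiniteDirected I) (p : LevelRep Iᵒᵖ f),
    ∀ t : I, P (relMatchingMap p.map t)

variable (C) [ModelCategory C]

/-- Strict weak equivalences: the essentially levelwise weak equivalences. -/
def strictWeakEquivalences : MorphismProperty (Pro C) :=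
  essentiallyLevelwise (weakEquivalences C)

/-- Strict fibrations: the retracts of special fibrations. -/
def strictFibrations : MorphismProperty (Pro C) :=
  (special (fibrations C)).retracts

/-- Strict acyclic fibrations: the strict fibrations that are strict weak equivalences. -/
def strictAcyclicFibrations : MorphismProperty (Pro C) :=
  strictFibrations C ⊓ strictWeakEquivalences C

end Strict

/-! ### Cocell complexes -/

/-- The `W`-cocell complexes in a category `D`: the projections `lim_{β < lam} Z_β ⟶ Z_0` of towers
`Z` indexed by a nonzero ordinal `lam` in the universe `w`, such that `Z_β = lim_{α < β} Z_α` for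
every limit ordinal `β < lam`, and such that each `Z_{β + 1} ⟶ Z_β` (for `β + 1 < lam`) is a base
change of a map in `W`. A tower in `D` is a transfinite sequence in `Dᵒᵖ`, so that the
cocell complexes are the opposites of the transfinite compositions in `Dᵒᵖ` of
the opposites of base changes of maps in `W`. -/
def cocellComplexes {D : Type u} [Category.{v} D] (W : MorphismProperty D) : MorphismProperty D :=
  (MorphismProperty.transfiniteCompositions.{w} W.pullbacks.op).unop

end StrictPro

/-!
Properness plays no role: everything comes from the two weak factorization systems of `C` and from
the description of `Pro C` by level representations.

*Levelwise cofibrations lift against cocell complexes.* A constant pro-object is finitely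
copresentable, so that a commutative square from a map `f` to a constant map factors through a term
of any level representation of `f`. Hence an essentially levelwise trivial cofibration has the left
lifting property with respect to constant fibrations, and an essentially levelwise cofibration with
respect to constant trivial fibrations (`essentiallyLevelwise_le_llp`); these lifting properties
extend to retracts of cocell complexes (`retracts_cocellComplexes_le`).

*Reedy factorizations.* Every map has a level representation indexed by a cofinite directed set, and
any map of diagrams over such a set factors, by induction on the number of elements below an index,
as a levelwise trivial cofibration followed by a map whose relative matching maps are fibrations,
and as a levelwise cofibration followed by a map whose relative matching maps are trivial fibrations
(`exists_levelwise_factorization`). By the retract argument, a map with the right lifting property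
against the first factor is a retract of the second one. So retracts of cocell complexes of constant
fibrations are strict fibrations (`strictFibrations_of_rlp`).

*Special fibrations are cocell complexes.* A map `p : X ⟶ Y` of diagrams over `I` is a single
diagram over two copies of `I`. Adding the terms of `X` to the diagram `Y` one at a time, along a
well-order extending the given order, writes `lim X ⟶ lim Y` as the projection of a tower whose
steps are base changes of the relative matching maps of `p` (`transfiniteCompositions_of_latching`,
`cocellComplexes_of_isLimit`). In `Pro C`, for the diagrams of constant pro-objects on `X` and `Y`,
this shows that special fibrations are cocell complexes of constant fibrations, and likewise for
trivial fibrations (`special_le_cocellComplexes`). In `C`, for the restrictions to the indices below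
`t`, it shows that `X_t ⟶ Y_t` is a cocell complex of relative matching maps, so that it is a
trivial fibration if these are (`trivialFibrations_app_of_relMatchingMap`).

*Strict weak equivalences are closed under retracts.* A map `f` has a level representation by maps
in a class `P` if and only if every map from `f` to a constant map factors through a constant map in
`P`, a condition which is inherited by retracts (`essentiallyLevelwise_iff_forall_constUnder`).
Hence retracts of cocell complexes of constant trivial fibrations, being retracts of maps whose
relative matching maps are trivial fibrations, are strict weak equivalences
(`strictAcyclicFibrations_of_rlp`). Conversely, in the factorization of a levelwise weak equivalence
as a levelwise cofibration followed by a map whose relative matching maps are trivial fibrations,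
the first factor is a levelwise trivial cofibration, so that the retract argument applies if the
given map is moreover a strict fibration (`strictAcyclicFibrations_le_retracts_cocellComplexes`).
-/

universe v' u'

namespace StrictPro

open Opposite

/-! ### Pro-objects as limits of constant pro-objects -/

namespace Pro

variable {C : Type u} [Category.{v} C]

instance : (Pro.const C).Full :=
  inferInstanceAs (Ind.yoneda (C := Cᵒᵖ)).rightOp.Full

instance : (Pro.const C).Faithful :=
  inferInstanceAs (Ind.yoneda (C := Cᵒᵖ)).rightOp.Faithful

noncomputable instance : PreservesFiniteLimits (Pro.const C) :=
  preservesFiniteLimits_rightOp (Ind.yoneda (C := Cᵒᵖ))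

instance [HasFiniteLimits C] : HasLimits (Pro C) :=
  inferInstanceAs (HasLimits (Ind Cᵒᵖ)ᵒᵖ)

/-- Representable ind-objects are finitely presentable: evaluation at `U` is a composition of
functors preserving filtered colimits. -/
noncomputable def coyonedaIndYonedaIso {E : Type u} [Category.{v} E] (U : E) :
    coyoneda.obj (op (Ind.yoneda.obj U)) ≅ Ind.inclusion E ⋙ (evaluation _ _).obj (op U) :=
  NatIso.ofComponents (fun A =>
    (Ind.inclusion.fullyFaithful.homEquiv.trans
      ((Iso.homCongr (Ind.yonedaCompInclusion.app U) (Iso.refl _)).trans yonedaEquiv)).toIso) (by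
    intro A B f
    ext g
    simp [yonedaEquiv, Functor.FullyFaithful.homEquiv])

instance {E : Type u} [Category.{v} E] (U : E) (I : Type v) [SmallCategory I] [IsFiltered I] :
    PreservesColimitsOfShape I (coyoneda.obj (op (Ind.yoneda.obj U))) :=
  preservesColimitsOfShape_of_natIso (coyonedaIndYonedaIso U).symm

variable {I : Type v} [SmallCategory I] [IsCofiltered I]

/-- Constant pro-objects are finitely copresentable: a map from a cofiltered limit to a constant
pro-object factors through one of the projections. -/
lemma exists_π_comp_eq {F : I ⥤ Pro C} {c : Cone F} (hc : IsLimit c) {A : C}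
    (g : c.pt ⟶ (Pro.const C).obj A) : ∃ (s : I) (g' : F.obj s ⟶ (Pro.const C).obj A),
      c.π.app s ≫ g' = g := by
  have h := isColimitOfPreserves (coyoneda.obj (op (Ind.yoneda.obj (op A))))
    (isColimitCoconeLeftOpOfCone F hc)
  obtain ⟨s, y, hy⟩ := Types.jointly_surjective_of_isColimit h g.unop
  exact ⟨s.unop, y.op, Quiver.Hom.unop_inj hy⟩

/-- Two maps to a constant pro-object which agree on a cofiltered limit agree at some stage. -/
lemma exists_map_comp_eq {F : I ⥤ Pro C} {c : Cone F} (hc : IsLimit c) {A : C} {s : I}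
    (g g' : F.obj s ⟶ (Pro.const C).obj A) (h : c.π.app s ≫ g = c.π.app s ≫ g') :
    ∃ (t : I) (a : t ⟶ s), F.map a ≫ g = F.map a ≫ g' := by
  have hh := isColimitOfPreserves (coyoneda.obj (op (Ind.yoneda.obj (op A))))
    (isColimitCoconeLeftOpOfCone F hc)
  obtain ⟨t, a, ha⟩ := (Types.FilteredColimit.isColimit_eq_iff' hh (i := op s)
    g.unop g'.unop).1 (congrArg Quiver.Hom.unop h)
  exact ⟨t.unop, a.unop, Quiver.Hom.unop_inj ha⟩

/-- The projection from the pro-object represented by a diagram to a term of this diagram. -/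
noncomputable def π (X : I ⥤ C) (s : I) :
    (Pro.ofDiagram I).obj X ⟶ (Pro.const C).obj (X.obj s) :=
  (colimit.ι (X.op ⋙ Ind.yoneda) (op s)).op

/-- The cone of all projections from the pro-object represented by a diagram. -/
noncomputable abbrev cone (X : I ⥤ C) : Cone (X ⋙ Pro.const C) where
  pt := (Pro.ofDiagram I).obj X
  π :=
    { app := π X
      naturality s t a := by
        refine (Category.id_comp _).trans (Quiver.Hom.unop_inj ?_)
        exact (colimit.w (X.op ⋙ Ind.yoneda) a.op).symm }

/-- The pro-object represented by a diagram is the limit of this diagram in `Pro C`. -/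
noncomputable def isLimitCone (X : I ⥤ C) : IsLimit (cone X) :=
  let coc (s : Cone (X ⋙ Pro.const C)) : Cocone (X.op ⋙ Ind.yoneda) :=
    { pt := s.pt.unop
      ι := { app t := (s.π.app t.unop).unop
             naturality t t' a := by
              refine Eq.trans ?_ (Category.comp_id _).symm
              exact congrArg Quiver.Hom.unop (s.w a.unop) } }
  { lift s := (colimit.desc _ (coc s)).op
    fac s t := Quiver.Hom.unop_inj (colimit.ι_desc (coc s) (op t))
    uniq s m hm := Quiver.Hom.unop_inj ((colimit.isColimit _).uniq (coc s) m.unop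
      fun t => congrArg Quiver.Hom.unop (hm t.unop)) }

lemma ofDiagram_map_π {X Y : I ⥤ C} (p : X ⟶ Y) (s : I) :
    (Pro.ofDiagram I).map p ≫ π Y s = π X s ≫ (Pro.const C).map (p.app s) := by
  refine Quiver.Hom.unop_inj ?_
  exact ι_colimMap (Functor.whiskerRight (NatTrans.op p) Ind.yoneda) (op s)

/-- A map between limits, in `Pro C`, of diagrams of constant pro-objects has a level
representation by any compatible natural transformation. -/
noncomputable def levelRepOfIsLimit {X Y : I ⥤ C} (p : X ⟶ Y) {c : Cone (X ⋙ Pro.const C)}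
    (hc : IsLimit c) {d : Cone (Y ⋙ Pro.const C)} (hd : IsLimit d) (f : c.pt ⟶ d.pt)
    (hf : ∀ s, f ≫ d.π.app s = c.π.app s ≫ (Pro.const C).map (p.app s)) : LevelRep I f where
  src := X
  tgt := Y
  map := p
  iso := Arrow.isoMk (hc.conePointUniqueUpToIso (isLimitCone X))
    (hd.conePointUniqueUpToIso (isLimitCone Y)) (by
      refine (isLimitCone Y).hom_ext fun s => ?_
      have h₁ := hc.conePointUniqueUpToIso_hom_comp (isLimitCone X) s
      have h₂ := hd.conePointUniqueUpToIso_hom_comp (isLimitCone Y) s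
      dsimp at h₁ h₂ ⊢
      rw [Category.assoc, Category.assoc, ofDiagram_map_π, h₂, hf, reassoc_of% h₁])

end Pro

namespace LevelRep

variable {C : Type u} [Category.{v} C] {I : Type v} [SmallCategory I] [IsCofiltered I]
  {A B : Pro C} {f : A ⟶ B} (r : LevelRep I f)

/-- The source of a map with a level representation, as a limit in `Pro C`. -/
noncomputable abbrev srcCone : Cone (r.src ⋙ Pro.const C) where
  pt := A
  π := (Functor.const I).map r.iso.hom.left ≫ (Pro.cone r.src).π

/-- The target of a map with a level representation, as a limit in `Pro C`. -/
noncomputable abbrev tgtCone : Cone (r.tgt ⋙ Pro.const C) where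
  pt := B
  π := (Functor.const I).map r.iso.hom.right ≫ (Pro.cone r.tgt).π

/-- The source of a map with a level representation is the limit of the representing diagram. -/
noncomputable def isLimitSrcCone : IsLimit r.srcCone :=
  (Pro.isLimitCone r.src).ofIsoLimit (Cone.ext (Arrow.leftFunc.mapIso r.iso.symm)
    (fun _ => (Arrow.leftFunc.mapIso r.iso).inv_hom_id_assoc _ |>.symm))

/-- The target of a map with a level representation is the limit of the representing diagram. -/
noncomputable def isLimitTgtCone : IsLimit r.tgtCone :=
  (Pro.isLimitCone r.tgt).ofIsoLimit (Cone.ext (Arrow.rightFunc.mapIso r.iso.symm)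
    (fun _ => (Arrow.rightFunc.mapIso r.iso).inv_hom_id_assoc _ |>.symm))

lemma comp_tgtCone_π (s : I) :
    f ≫ r.tgtCone.π.app s = r.srcCone.π.app s ≫ (Pro.const C).map (r.map.app s) := by
  have h : f ≫ r.iso.hom.right = r.iso.hom.left ≫ (Pro.ofDiagram I).map r.map :=
    (Arrow.w r.iso.hom).symm
  change f ≫ r.iso.hom.right ≫ Pro.π r.tgt s =
    (r.iso.hom.left ≫ Pro.π r.src s) ≫ _
  rw [reassoc_of% h, Pro.ofDiagram_map_π, Category.assoc]

/-- Restriction of a level representation along an initial functor. -/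
noncomputable def restrict {J : Type v} [SmallCategory J] [IsCofiltered J] (G : J ⥤ I)
    [G.Initial] : LevelRep J f :=
  Pro.levelRepOfIsLimit (X := G ⋙ r.src) (Y := G ⋙ r.tgt) (Functor.whiskerLeft G r.map)
    ((Functor.Initial.isLimitWhiskerEquiv G _).symm r.isLimitSrcCone)
    ((Functor.Initial.isLimitWhiskerEquiv G _).symm r.isLimitTgtCone) f
    (fun s => r.comp_tgtCone_π (G.obj s))

/-- Transport of a level representation along an isomorphism in the arrow category. -/
noncomputable def ofArrowIso {A' B' : Pro C} {f' : A' ⟶ B'} (e : Arrow.mk f' ≅ Arrow.mk f) :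
    LevelRep I f' where
  src := r.src
  tgt := r.tgt
  map := r.map
  iso := e ≪≫ r.iso

end LevelRep

/-- Every map of pro-objects has a level representation. -/
lemma exists_levelRep {C : Type u} [Category.{v} C] {A B : Pro C} (f : A ⟶ B) :
    ∃ (I : Type v) (_ : SmallCategory I) (_ : IsCofiltered I), Nonempty (LevelRep I f) := by
  obtain ⟨I, _, _, F, G, φ, ⟨e⟩⟩ := Ind.exists_nonempty_arrow_mk_iso_ind_lim (f := f.unop)
  have hG : IsLimit (F := G.leftOp ⋙ Pro.const C) (colimit.cocone (G ⋙ Ind.yoneda)).op :=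
    (colimit.isColimit (G ⋙ Ind.yoneda)).op
  have hF : IsLimit (F := F.leftOp ⋙ Pro.const C) (colimit.cocone (F ⋙ Ind.yoneda)).op :=
    (colimit.isColimit (F ⋙ Ind.yoneda)).op
  let r := Pro.levelRepOfIsLimit (NatTrans.leftOp φ) hG hF ((Ind.lim I).map φ).op (fun s =>
    Quiver.Hom.unop_inj (ι_colimMap (Functor.whiskerRight φ Ind.yoneda) s.unop))
  refine ⟨Iᵒᵖ, inferInstance, inferInstance, ⟨r.ofArrowIso ?_⟩⟩
  exact Arrow.isoMk (Arrow.rightFunc.mapIso e).symm.op (Arrow.leftFunc.mapIso e).symm.op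
    (Quiver.Hom.unop_inj (Arrow.w e.inv).symm)

/-! ### Reindexing by cofinite directed sets -/

/-- The finite subsets of `α` having a greatest element, ordered by inclusion. -/
abbrev FinsetWithGreatest (α : Type w) [PartialOrder α] : Type w :=
  {S : Finset α // ∃ m, IsGreatest (S : Set α) m}

namespace FinsetWithGreatest

variable {α : Type w} [PartialOrder α]

/-- The greatest element of a finite set having one. -/
noncomputable def greatest (S : FinsetWithGreatest α) : α := S.2.choose

lemma isGreatest (S : FinsetWithGreatest α) : IsGreatest (S.1 : Set α) S.greatest :=
  S.2.choose_spec

lemma monotone_greatest : Monotone (greatest (α := α)) := fun S T h =>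
  T.isGreatest.2 (h S.isGreatest.1)

lemma exists_greatest_eq (a : α) : ∃ S : FinsetWithGreatest α, S.greatest = a :=
  let S : FinsetWithGreatest α := ⟨{a}, a, by simp⟩
  ⟨S, by simpa [S] using S.isGreatest.1⟩

instance [IsDirectedOrder α] [Nonempty α] : IsCofiniteDirected (FinsetWithGreatest α) where
  nonempty := ⟨(exists_greatest_eq (Classical.arbitrary α)).choose⟩
  directed S T := by
    classical
    obtain ⟨u, hS, hT⟩ := exists_ge_ge S.greatest T.greatest
    refine ⟨⟨insert u (S.1 ∪ T.1), u, by simp, ?_⟩, ?_, ?_⟩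
    · intro x hx
      simp only [Finset.coe_insert, Finset.coe_union, Set.mem_insert_iff, Set.mem_union] at hx
      obtain rfl | hx | hx := hx
      · exact le_rfl
      · exact (S.isGreatest.2 hx).trans hS
      · exact (T.isGreatest.2 hx).trans hT
    · exact Finset.subset_union_left.trans (Finset.subset_insert _ _)
    · exact Finset.subset_union_right.trans (Finset.subset_insert _ _)
  finite_le S := Set.Finite.of_finite_image (f := Subtype.val)
    ((Finset.finite_toSet S.1.powerset).subset (by
      rintro _ ⟨T, hT, rfl⟩
      exact Finset.mem_coe.2 (Finset.mem_powerset.2 hT))) Subtype.val_injective.injOn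

instance [IsDirectedOrder α] [Nonempty α] : (monotone_greatest (α := α)).functor.Final := by
  have : IsDirectedOrder (FinsetWithGreatest α) := ⟨IsCofiniteDirected.directed⟩
  rw [Monotone.final_functor_iff]
  intro a
  obtain ⟨S, hS⟩ := exists_greatest_eq a
  exact ⟨S, hS.ge⟩

end FinsetWithGreatest

/-- Every small cofiltered category receives an initial functor from the opposite of a cofinite
directed set. -/
lemma exists_initial_functor (I : Type v) [SmallCategory I] [IsCofiltered I] :
    ∃ (J : Type v) (_ : PartialOrder J) (_ : IsCofiniteDirected J) (G : Jᵒᵖ ⥤ I), G.Initial := by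
  obtain ⟨α, _, _, _, F, _⟩ := IsFiltered.exists_directed Iᵒᵖ
  exact ⟨FinsetWithGreatest α, inferInstance, inferInstance,
    (FinsetWithGreatest.monotone_greatest.functor ⋙ F).leftOp, inferInstance⟩

/-- A level representation whose components satisfy `P` can be reindexed by a cofinite directed
set. -/
lemma essentiallyLevelwise.exists_cofiniteDirected {C : Type u} [Category.{v} C]
    {P : MorphismProperty C} {A B : Pro C} {f : A ⟶ B} (hf : essentiallyLevelwise P f) :
    ∃ (J : Type v) (_ : PartialOrder J) (_ : IsCofiniteDirected J) (r : LevelRep Jᵒᵖ f),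
      ∀ s, P (r.map.app s) := by
  obtain ⟨I, _, _, r, hr⟩ := hf
  obtain ⟨J, _, _, G, _⟩ := exists_initial_functor I
  exact ⟨J, inferInstance, inferInstance, r.restrict G, fun s => hr (G.obj s)⟩

/-! ### Lifting properties of cocell complexes -/

section Lifting

variable {C : Type u} [Category.{v} C]

/-- A commutative square from a map of pro-objects to a constant map factors through some term of
any given level representation. -/
lemma LevelRep.exists_factor {A B : Pro C} {f : A ⟶ B} {I : Type v} [SmallCategory I]
    [IsCofiltered I] (r : LevelRep I f) {X Y : C} (q : X ⟶ Y) (u : A ⟶ (Pro.const C).obj X)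
    (v : B ⟶ (Pro.const C).obj Y) (w : u ≫ (Pro.const C).map q = f ≫ v) :
    ∃ (t : I) (u' : r.src.obj t ⟶ X) (v' : r.tgt.obj t ⟶ Y), u' ≫ q = r.map.app t ≫ v' ∧
      r.srcCone.π.app t ≫ (Pro.const C).map u' = u ∧
      r.tgtCone.π.app t ≫ (Pro.const C).map v' = v := by
  obtain ⟨s₁, u₁, hu⟩ := Pro.exists_π_comp_eq r.isLimitSrcCone u
  obtain ⟨s₂, v₁, hv⟩ := Pro.exists_π_comp_eq r.isLimitTgtCone v
  obtain ⟨u₁, rfl⟩ := (Pro.const C).map_surjective u₁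
  obtain ⟨v₁, rfl⟩ := (Pro.const C).map_surjective v₁
  let s := IsCofiltered.min s₁ s₂
  let a₁ : s ⟶ s₁ := IsCofiltered.minToLeft _ _
  let a₂ : s ⟶ s₂ := IsCofiltered.minToRight _ _
  have hu' : u = r.srcCone.π.app s ≫ (Pro.const C).map (r.src.map a₁ ≫ u₁) := by
    rw [← hu, ← r.srcCone.w a₁, Functor.map_comp, Category.assoc]; rfl
  have hv' : v = r.tgtCone.π.app s ≫ (Pro.const C).map (r.tgt.map a₂ ≫ v₁) := by
    rw [← hv, ← r.tgtCone.w a₂, Functor.map_comp, Category.assoc]; rfl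
  obtain ⟨t, b, hb⟩ := Pro.exists_map_comp_eq r.isLimitSrcCone (s := s)
    ((Pro.const C).map ((r.src.map a₁ ≫ u₁) ≫ q))
    ((Pro.const C).map (r.map.app s ≫ r.tgt.map a₂ ≫ v₁)) (by
      rw [Functor.map_comp _ _ q, ← Category.assoc, ← hu', w, hv', Functor.map_comp _ _ (_ ≫ _),
        ← Category.assoc, r.comp_tgtCone_π, Category.assoc])
  have hb' : r.src.map b ≫ (r.src.map a₁ ≫ u₁) ≫ q =
      r.src.map b ≫ r.map.app s ≫ r.tgt.map a₂ ≫ v₁ :=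
    (Pro.const C).map_injective (by
      rw [Functor.map_comp, Functor.map_comp _ (r.src.map b)]; exact hb)
  refine ⟨t, r.src.map b ≫ r.src.map a₁ ≫ u₁, r.tgt.map b ≫ r.tgt.map a₂ ≫ v₁, ?_, ?_, ?_⟩
  · simp only [Category.assoc] at hb' ⊢
    rw [hb', NatTrans.naturality_assoc]
  · rw [hu', ← r.srcCone.w b, Functor.map_comp, Category.assoc]; rfl
  · rw [hv', ← r.tgtCone.w b, Functor.map_comp, Category.assoc]; rfl

/-- Liftings against constant maps can be found in a single term of a level representation. -/
lemma essentiallyLevelwise_le_llp {L R : MorphismProperty C} (h : L ≤ R.llp) :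
    essentiallyLevelwise L ≤ (R.strictMap (Pro.const C)).llp := by
  rintro A B f ⟨I, _, _, r, hr⟩ _ _ _ ⟨hq⟩
  rename_i X Y q
  constructor
  intro u v sq
  obtain ⟨t, u', v', sq', rfl, rfl⟩ := r.exists_factor q u v sq.w
  have := h _ (hr t) _ hq
  have sq'' : CommSq u' (r.map.app t) q v' := ⟨sq'⟩
  refine ⟨⟨{ l := r.tgtCone.π.app t ≫ (Pro.const C).map sq''.lift
             fac_left := ?_
             fac_right := ?_ }⟩⟩
  · rw [← Category.assoc, r.comp_tgtCone_π, Category.assoc, ← Functor.map_comp, sq''.fac_left]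
  · rw [Category.assoc, ← Functor.map_comp, sq''.fac_right]

/-- The dual of the fact that transfinite compositions of cobase changes of maps in a class have
the left lifting property against the maps having the right lifting property against this class. -/
lemma cocellComplexes_le_rlp_llp {D : Type u} [Category.{v} D] (W : MorphismProperty D) :
    cocellComplexes.{w} W ≤ W.llp.rlp := by
  intro X Y f hf A B i hi
  have hf' : W.pullbacks.op.rlp.llp f.op :=
    MorphismProperty.transfiniteCompositions_le_llp_rlp _ _ hf
  have hi' : W.pullbacks.op.rlp i.op := by
    rintro _ _ q ⟨_, _, p, _, _, hp, sq⟩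
    have := hi _ hp
    have : HasLiftingProperty i q.unop := sq.hasLiftingProperty i
    exact HasLiftingProperty.op (i := i) (p := q.unop) inferInstance
  exact (hf' _ hi').unop

end Lifting

/-! ### Factorizations of levelwise maps -/

section Factorization

variable {I : Type w} [PartialOrder I] [IsCofiniteDirected I]
  {C : Type u} [Category.{v} C] [HasFiniteLimits C]

lemma relMatchingMap_fst {X Y : Iᵒᵖ ⥤ C} (p : X ⟶ Y) (t : I) :
    relMatchingMap p t ≫ pullback.fst _ _ = toMatching X t :=
  pullback.lift_fst _ _ _

lemma relMatchingMap_snd {X Y : Iᵒᵖ ⥤ C} (p : X ⟶ Y) (t : I) :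
    relMatchingMap p t ≫ pullback.snd _ _ = p.app (op t) :=
  pullback.lift_snd _ _ _

lemma toMatching_π_mk (X : Iᵒᵖ ⥤ C) {s t : I} (h : s < t) :
    toMatching X t ≫ limit.π (below X t) (op ⟨s, h⟩) = X.map (homOfLE h.le).op :=
  toMatching_π _ _ _

lemma matchingMap_π_mk {X Y : Iᵒᵖ ⥤ C} (p : X ⟶ Y) {s t : I} (h : s < t) :
    matchingMap p t ≫ limit.π (below Y t) (op ⟨s, h⟩) =
      limit.π (below X t) (op ⟨s, h⟩) ≫ p.app (op s) :=
  matchingMap_π _ _ _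

lemma limit_π_below_map (X : Iᵒᵖ ⥤ C) {r s t : I} (h : s < t) (h' : r ≤ s) :
    limit.π (below X t) (op ⟨s, h⟩) ≫ X.map (homOfLE h').op =
      limit.π (below X t) (op ⟨r, h'.trans_lt h⟩) :=
  limit.w (below X t) (j := op ⟨s, h⟩) (j' := op ⟨r, h'.trans_lt h⟩)
    (homOfLE (show (⟨r, h'.trans_lt h⟩ : Set.Iio t) ≤ ⟨s, h⟩ from h')).op

lemma matchingMap_comp {X Y Z : Iᵒᵖ ⥤ C} (p : X ⟶ Y) (q : Y ⟶ Z) (t : I) :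
    matchingMap (p ≫ q) t = matchingMap p t ≫ matchingMap q t := by
  refine limit.hom_ext fun ⟨s, h⟩ => ?_
  have h₁ := matchingMap_π_mk (p ≫ q) h
  have h₂ := matchingMap_π_mk q h
  rw [Category.assoc, h₁, h₂, reassoc_of% (matchingMap_π_mk p h), NatTrans.comp_app]

lemma isIso_matchingMap {X Y : Iᵒᵖ ⥤ C} (p : X ⟶ Y) (t : I)
    (h : ∀ s < t, IsIso (p.app (op s))) : IsIso (matchingMap p t) := by
  have (s : (Set.Iio t)ᵒᵖ) : IsIso ((Functor.whiskerLeft (belowIncl t).op p).app s) := h _ s.unop.2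
  have := NatIso.isIso_of_isIso_app (Functor.whiskerLeft (belowIncl t).op p)
  exact inferInstanceAs (IsIso (limMap _))

section

variable {X Z Y : Iᵒᵖ ⥤ C} (j : X ⟶ Z) {q : Z ⟶ Y} {p : X ⟶ Y} (fac : j ≫ q = p) (t : I)

/-- The map between targets of relative matching maps induced by a map over `Y`. -/
noncomputable def relMatchingObjMap :
    pullback (matchingMap p t) (toMatching Y t) ⟶ pullback (matchingMap q t) (toMatching Y t) :=
  pullback.map _ _ _ _ (matchingMap j t) (𝟙 _) (𝟙 _)
    (by rw [← fac, matchingMap_comp, Category.comp_id]) (by simp)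

lemma relMatchingObjMap_fst :
    relMatchingObjMap j fac t ≫ pullback.fst _ _ = pullback.fst _ _ ≫ matchingMap j t :=
  pullback.lift_fst _ _ _

lemma relMatchingObjMap_snd :
    relMatchingObjMap j fac t ≫ pullback.snd _ _ = pullback.snd _ _ :=
  (pullback.lift_snd _ _ _).trans (Category.comp_id _)

lemma isIso_relMatchingObjMap (h : ∀ s < t, IsIso (j.app (op s))) :
    IsIso (relMatchingObjMap j fac t) := by
  have := isIso_matchingMap j t h
  delta relMatchingObjMap
  infer_instance

lemma relMatchingMap_comp_relMatchingObjMap :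
    relMatchingMap p t ≫ relMatchingObjMap j fac t = j.app (op t) ≫ relMatchingMap q t := by
  apply pullback.hom_ext
  · rw [Category.assoc, relMatchingObjMap_fst, reassoc_of% relMatchingMap_fst, Category.assoc,
      relMatchingMap_fst, toMatching_naturality]
  · rw [Category.assoc, relMatchingObjMap_snd, relMatchingMap_snd, Category.assoc,
      relMatchingMap_snd, ← fac, NatTrans.comp_app]

include fac in
/-- The relative matching map at `t` only depends, up to isomorphism, on the values at the
elements `s ≤ t`. -/
lemma relMatchingMap_mem_of_isIso {W : MorphismProperty C} [W.RespectsIso]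
    (h : ∀ s ≤ t, IsIso (j.app (op s))) (hW : W (relMatchingMap p t)) :
    W (relMatchingMap q t) := by
  have := h t le_rfl
  have := isIso_relMatchingObjMap j fac t (fun s hs => h s hs.le)
  rw [← W.cancel_left_of_respectsIso (j.app (op t)),
    ← relMatchingMap_comp_relMatchingObjMap j fac, W.cancel_right_of_respectsIso]
  exact hW

end

section Step

variable {Z Y : Iᵒᵖ ⥤ C} (q : Z ⟶ Y) {M : I → C} (a : ∀ t, Z.obj (op t) ⟶ M t)
  (b : ∀ t, M t ⟶ pullback (matchingMap q t) (toMatching Y t))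

/-- The transition map, for `s < t`, in the diagram of middle objects of factorizations
of the relative matching maps. -/
noncomputable def stepMap {s t : I} (h : s < t) : M t ⟶ M s :=
  b t ≫ pullback.fst _ _ ≫ limit.π (below Z t) (op ⟨s, h⟩) ≫ a s

variable {q a b} (fac : ∀ t, a t ≫ b t = relMatchingMap q t)

include fac

lemma stepMap_fst_π {r s t : I} (h : s < t) (h' : r < s) :
    stepMap q a b h ≫ b s ≫ pullback.fst _ _ ≫ limit.π (below Z s) (op ⟨r, h'⟩) =
      b t ≫ pullback.fst _ _ ≫ limit.π (below Z t) (op ⟨r, h'.trans h⟩) := by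
  simp only [stepMap, Category.assoc]
  rw [reassoc_of% (fac s), reassoc_of% relMatchingMap_fst, toMatching_π_mk, limit_π_below_map]

lemma stepMap_comp {r s t : I} (h : s < t) (h' : r < s) :
    stepMap q a b h ≫ stepMap q a b h' = stepMap q a b (h'.trans h) := by
  have := stepMap_fst_π fac h h'
  simp only [stepMap, Category.assoc] at this ⊢
  rw [reassoc_of% this]

lemma comp_stepMap {s t : I} (h : s < t) :
    a t ≫ stepMap q a b h = Z.map (homOfLE h.le).op ≫ a s := by
  simp only [stepMap]
  rw [reassoc_of% (fac t), reassoc_of% relMatchingMap_fst, reassoc_of% toMatching_π_mk]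

lemma stepMap_snd {s t : I} (h : s < t) :
    stepMap q a b h ≫ b s ≫ pullback.snd _ _ =
      (b t ≫ pullback.snd _ _) ≫ Y.map (homOfLE h.le).op := by
  simp only [stepMap, Category.assoc]
  rw [reassoc_of% (fac s), relMatchingMap_snd, ← matchingMap_π_mk, pullback.condition_assoc,
    toMatching_π_mk]

open Classical in
/-- The diagram of middle objects of factorizations of all relative matching maps. -/
noncomputable abbrev stepDiagram : Iᵒᵖ ⥤ C where
  obj t := M t.unop
  map {t s} f := if h : s.unop = t.unop then eqToHom (by rw [h]) else
    stepMap q a b (lt_of_le_of_ne (leOfHom f.unop) h)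
  map_id t := by simp
  map_comp {t s r} f g := by
    obtain ⟨t⟩ := t
    obtain ⟨s⟩ := s
    obtain ⟨r⟩ := r
    have hst : s ≤ t := leOfHom f.unop
    have hrs : r ≤ s := leOfHom g.unop
    dsimp only
    by_cases h : s = t
    · subst h
      simp
    · by_cases h' : r = s
      · subst h'
        simp
      · have h'' : r ≠ t := fun e => h (le_antisymm hst (e ▸ hrs))
        rw [dif_neg h, dif_neg h', dif_neg h'', stepMap_comp fac]

lemma stepDiagram_map {s t : I} (h : s < t) :
    (stepDiagram fac).map (homOfLE h.le).op = stepMap q a b h :=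
  dif_neg h.ne

/-- The map from the original diagram to the diagram of middle objects. -/
noncomputable def toStepDiagram : Z ⟶ stepDiagram fac where
  app t := a t.unop
  naturality t s f := by
    obtain ⟨t⟩ := t
    obtain ⟨s⟩ := s
    obtain rfl | h := (show s ≤ t from leOfHom f.unop).eq_or_lt
    · obtain rfl : f = 𝟙 _ := Subsingleton.elim _ _
      rw [CategoryTheory.Functor.map_id, CategoryTheory.Functor.map_id, Category.id_comp,
        Category.comp_id]
    · obtain rfl : f = (homOfLE h.le).op := Subsingleton.elim _ _
      rw [stepDiagram_map fac h]
      exact (comp_stepMap fac h).symm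

/-- The map from the diagram of middle objects to the base. -/
noncomputable def fromStepDiagram : stepDiagram fac ⟶ Y where
  app t := b t.unop ≫ pullback.snd _ _
  naturality t s f := by
    obtain ⟨t⟩ := t
    obtain ⟨s⟩ := s
    obtain rfl | h := (show s ≤ t from leOfHom f.unop).eq_or_lt
    · obtain rfl : f = 𝟙 _ := Subsingleton.elim _ _
      rw [CategoryTheory.Functor.map_id, CategoryTheory.Functor.map_id, Category.id_comp,
        Category.comp_id]
    · obtain rfl : f = (homOfLE h.le).op := Subsingleton.elim _ _
      rw [stepDiagram_map fac h]
      exact stepMap_snd fac h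

lemma toStepDiagram_comp_fromStepDiagram : toStepDiagram fac ≫ fromStepDiagram fac = q := by
  ext t
  change a t.unop ≫ b t.unop ≫ pullback.snd _ _ = _
  rw [reassoc_of% (fac t.unop), relMatchingMap_snd]

lemma relMatchingMap_fromStepDiagram (t : I) :
    b t ≫ relMatchingObjMap (toStepDiagram fac) (toStepDiagram_comp_fromStepDiagram fac) t =
      relMatchingMap (fromStepDiagram fac) t := by
  apply pullback.hom_ext
  · rw [Category.assoc, relMatchingObjMap_fst, relMatchingMap_fst]
    refine limit.hom_ext fun ⟨s, h⟩ => ?_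
    have h₁ := toMatching_π_mk (stepDiagram fac) h
    have h₂ := matchingMap_π_mk (toStepDiagram fac) h
    rw [h₁, stepDiagram_map fac h, Category.assoc, Category.assoc, h₂]
    rfl
  · rw [Category.assoc, relMatchingObjMap_snd, relMatchingMap_snd]
    rfl

end Step

variable {W₁ W₂ : MorphismProperty C} [W₁.HasFactorization W₂]

/-- Over an antichain `A`, the diagram `Z` over `Y` can be modified so that the relative matching
maps at elements of `A` belong to `W₂`. -/
lemma exists_step [W₂.RespectsIso] {Z Y : Iᵒᵖ ⥤ C} (q : Z ⟶ Y) (A : Set I)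
    (hA : ∀ t ∈ A, ∀ s < t, s ∉ A) :
    ∃ (Z' : Iᵒᵖ ⥤ C) (j : Z ⟶ Z') (q' : Z' ⟶ Y), j ≫ q' = q ∧
      (∀ t ∉ A, IsIso (j.app (op t))) ∧
      ∀ t ∈ A, W₁ (j.app (op t)) ∧ W₂ (relMatchingMap q' t) := by
  have (t : I) : ∃ (M : C) (a : Z.obj (op t) ⟶ M)
      (b : M ⟶ pullback (matchingMap q t) (toMatching Y t)), a ≫ b = relMatchingMap q t ∧
      (t ∉ A → IsIso a) ∧ (t ∈ A → W₁ a ∧ W₂ b) := by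
    -- outside `A`, the trivial factorization leaves `Z` unchanged
    by_cases ht : t ∈ A
    · let d := MorphismProperty.factorizationData W₁ W₂ (relMatchingMap q t)
      exact ⟨_, d.i, d.p, d.fac, fun h => (h ht).elim, fun _ => ⟨d.hi, d.hp⟩⟩
    · exact ⟨_, 𝟙 _, _, Category.id_comp _, fun _ => inferInstance, fun h => (ht h).elim⟩
  choose M a b fac iso mem using this
  refine ⟨_, toStepDiagram fac, fromStepDiagram fac, toStepDiagram_comp_fromStepDiagram fac,
    iso, fun t ht => ⟨(mem t ht).1, ?_⟩⟩
  -- as no `s < t` is in `A`, the target of the relative matching map at `t` is unchanged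
  have := isIso_relMatchingObjMap (toStepDiagram fac)
    (toStepDiagram_comp_fromStepDiagram fac) t (fun s hs => iso s (hA t ht s hs))
  rw [← relMatchingMap_fromStepDiagram fac]
  refine (W₂.cancel_right_of_respectsIso (b t) _).2 ?_
  exact (mem t ht).2

/-- The number of elements below an element of a cofinite directed set. -/
noncomputable def height (t : I) : ℕ := (Set.Iio t).ncard

lemma height_lt {s t : I} (h : s < t) : height s < height t :=
  Set.ncard_lt_ncard ⟨fun _ hr => lt_trans hr h, fun h' => lt_irrefl _ (h' h)⟩
    (Set.toFinite (Set.Iio t))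

variable (W₁ W₂) in
/-- The successive approximations of the factorization: stage `n` is correct at the elements of
height less than `n`, and agrees with `X` at the other elements. -/
lemma exists_tower [W₂.RespectsIso] {X Y : Iᵒᵖ ⥤ C} (p : X ⟶ Y) :
    ∃ (F : ℕ ⥤ Over Y) (_ : F.obj 0 = Over.mk p), ∀ (n : ℕ) (t : I),
      (height t ≠ n → IsIso ((F.map (homOfLE (Nat.le_add_right n 1))).left.app (op t))) ∧
      (height t = n → W₁ ((F.map (homOfLE (Nat.le_add_right n 1))).left.app (op t)) ∧
        W₂ (relMatchingMap (F.obj (n + 1)).hom t)) := by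
  have hstep (n : ℕ) (T : Over Y) : ∃ (T' : Over Y) (j : T ⟶ T'),
      (∀ t : I, height t ≠ n → IsIso (j.left.app (op t))) ∧
      ∀ t : I, height t = n → W₁ (j.left.app (op t)) ∧ W₂ (relMatchingMap T'.hom t) := by
    obtain ⟨Z', j, q', fac, h₁, h₂⟩ := exists_step (W₁ := W₁) (W₂ := W₂) T.hom
      {t | height t = n} (fun t ht s hs hs' => (height_lt hs).ne (hs'.trans ht.symm))
    exact ⟨Over.mk q', Over.homMk j fac, h₁, h₂⟩
  choose T' j iso mem using hstep
  let T : ℕ → Over Y := fun n => Nat.rec (Over.mk p) T' n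
  refine ⟨Functor.ofSequence (X := T) (fun n => j n (T n)), rfl, fun n t => ?_⟩
  rw [Functor.ofSequence_map_homOfLE_succ (X := T) (fun n => j n (T n)) n]
  exact ⟨iso n (T n) t, mem n (T n) t⟩

/-- Any map of diagrams on a cofinite directed set factors as a levelwise `W₁`-map followed by a
map whose relative matching maps are in `W₂`, provided that any map factors as a `W₁`-map followed
by a `W₂`-map. -/
lemma exists_levelwise_factorization [W₁.RespectsIso] [W₂.RespectsIso] {X Y : Iᵒᵖ ⥤ C}
    (p : X ⟶ Y) : ∃ (Z : Iᵒᵖ ⥤ C) (i : X ⟶ Z) (q : Z ⟶ Y), i ≫ q = p ∧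
      (∀ t, W₁ (i.app t)) ∧ ∀ t, W₂ (relMatchingMap q t) := by
  obtain ⟨F, hF, h⟩ := exists_tower W₁ W₂ p
  suffices ∃ (Z : Iᵒᵖ ⥤ C) (i : (F.obj 0).left ⟶ Z) (q : Z ⟶ Y), i ≫ q = (F.obj 0).hom ∧
      (∀ t, W₁ (i.app t)) ∧ ∀ t, W₂ (relMatchingMap q t) by
    rw [hF] at this
    exact this
  -- at each index, the tower is eventually constant, and its only non-invertible transition map
  -- is a `W₁`-map; its colimit thus exists and has the required properties
  let G : ℕ ⥤ Iᵒᵖ ⥤ C := F ⋙ Over.forget Y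
  have hiso (t : I) (n m : ℕ) (hnm : n ≤ m) (hm : m ≤ height t ∨ height t < n) :
      IsIso ((G.map (homOfLE hnm)).app (op t)) := by
    induction m, hnm using Nat.le_induction with
    | base =>
      have : G.map (homOfLE (le_refl n)) = 𝟙 _ := G.map_id n
      rw [this]
      infer_instance
    | succ m hnm ih =>
      have := ih (by omega)
      have : IsIso ((G.map (homOfLE (Nat.le_add_right m 1))).app (op t)) := (h m t).1 (by omega)
      rw [← homOfLE_comp hnm (Nat.le_add_right m 1), G.map_comp, NatTrans.comp_app]
      infer_instance
  have hconst (t : I) : (G.flip.obj (op t)).IsEventuallyConstantFrom (height t + 1) :=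
    fun m f => hiso t _ m (leOfHom f) (Or.inr (Nat.lt_succ_self _))
  let c : Cocone G := combineCocones G fun t => ⟨_, (hconst t.unop).isColimitCocone⟩
  have hc : IsColimit c := combinedIsColimit _ _
  have hι (t : I) (n : ℕ) (hn : height t < n) : IsIso ((c.ι.app n).app (op t)) :=
    (hconst t).isIso_ι_of_isColimit' (hconst t).isColimitCocone n (homOfLE hn)
  clear_value c
  let d : Cocone G :=
    { pt := Y
      ι := { app n := (F.obj n).hom
             naturality n m f := (Over.w (F.map f)).trans (Category.comp_id _).symm } }
  refine ⟨c.pt, c.ι.app 0, hc.desc d, hc.fac d 0, fun ⟨t⟩ => ?_, fun t => ?_⟩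
  · have := hiso t 0 (height t) (Nat.zero_le _) (Or.inl le_rfl)
    have := hι t (height t + 1) (Nat.lt_succ_self _)
    rw [← c.w (homOfLE (Nat.zero_le (height t))),
      ← c.w (homOfLE (Nat.le_add_right (height t) 1)), NatTrans.comp_app, NatTrans.comp_app]
    refine (W₁.cancel_left_of_respectsIso
      ((G.map (homOfLE (Nat.zero_le (height t)))).app (op t)) _).2 ?_
    exact (W₁.cancel_right_of_respectsIso _ _).2 ((h _ t).2 rfl).1
  · refine relMatchingMap_mem_of_isIso (c.ι.app (height t + 1)) (hc.fac d (height t + 1)) t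
      (fun s hs => hι s _ ?_) ((h _ t).2 rfl).2
    obtain rfl | h := hs.eq_or_lt
    · exact Nat.lt_succ_self _
    · exact (height_lt h).trans (Nat.lt_succ_self _)

end Factorization

/-! ### Transfinite compositions from filtrations of partially ordered sets -/

section Filtration

variable {T : Type w} [PartialOrder T] {D : Type u} [Category.{v} D] (G : T ⥤ D)

/-- The restriction of a diagram to a subset of the indexing partially ordered set. -/
abbrev restr (S : Set T) : S ⥤ D where
  obj x := G.obj x.1
  map {x y} f := G.map (homOfLE (show x.1 ≤ y.1 from leOfHom f))
  map_id x := G.map_id x.1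
  map_comp _ _ := by rw [← G.map_comp]; rfl

variable {G} in
lemma restr_w {S : Set T} (c : Cocone (restr G S)) {x y : T} (h : x ≤ y) (hx : x ∈ S) (hy : y ∈ S) :
    G.map (homOfLE h) ≫ c.ι.app ⟨y, hy⟩ = c.ι.app ⟨x, hx⟩ :=
  c.w (homOfLE (show (⟨x, hx⟩ : S) ≤ ⟨y, hy⟩ from h))

/-- Constructor for cocones over a restricted diagram. -/
abbrev restrCocone (S : Set T) {A : D} (φ : ∀ x ∈ S, G.obj x ⟶ A)
    (hφ : ∀ x y (h : x ≤ y) (hx : x ∈ S) (hy : y ∈ S), G.map (homOfLE h) ≫ φ y hy = φ x hx) :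
    Cocone (restr G S) where
  pt := A
  ι := { app x := φ x.1 x.2
         naturality x y f := (hφ _ _ (leOfHom f) x.2 y.2).trans (Category.comp_id _).symm }

/-- The cocone given by the maps `G.obj y ⟶ G.obj x` for `y < x`. The map induced on the colimit is
the latching map at `x`. -/
abbrev latchingCocone (x : T) : Cocone (restr G (Set.Iio x)) :=
  restrCocone G _ (fun _ hy => G.map (homOfLE (le_of_lt hy))) (fun _ _ _ _ _ => by
    rw [← G.map_comp]; rfl)

/-- The map between the colimits of the restrictions of a diagram to two nested subsets. -/
noncomputable def restrColimMap {S S' : Set T} [HasColimit (restr G S)] [HasColimit (restr G S')]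
    (h : ∀ ⦃x⦄, x ∈ S → x ∈ S') : colimit (restr G S) ⟶ colimit (restr G S') :=
  colimit.desc (restr G S) (restrCocone G _
    (fun x hx => colimit.ι (restr G S') ⟨x, h hx⟩)
    (fun _ _ h _ _ => restr_w (colimit.cocone (restr G S')) h _ _))

lemma ι_restrColimMap {S S' : Set T} [HasColimit (restr G S)] [HasColimit (restr G S')]
    (h : ∀ ⦃x⦄, x ∈ S → x ∈ S') (x : T) (hx : x ∈ S) :
    colimit.ι (restr G S) ⟨x, hx⟩ ≫ restrColimMap G h = colimit.ι (restr G S') ⟨x, h hx⟩ :=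
  colimit.ι_desc (restrCocone G _ _ _) (⟨x, hx⟩ : S)

section

variable {J : Type w} [LinearOrder J] (S : J → Set T)
  (hS : ∀ ⦃i j⦄, i ≤ j → ∀ ⦃x⦄, x ∈ S i → x ∈ S j)
  [∀ j, HasColimit (restr G (S j))]

/-- The diagram of colimits over the stages of a filtration of the indexing partially ordered
set. -/
noncomputable def filtrationColim : J ⥤ D where
  obj j := colimit (restr G (S j))
  map {i j} f := restrColimMap G (hS (leOfHom f))
  map_id j := colimit.hom_ext fun ⟨x, hx⟩ =>
    (ι_restrColimMap G _ x hx).trans (Category.comp_id _).symm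
  map_comp f g := colimit.hom_ext fun ⟨x, hx⟩ => by
    rw [ι_restrColimMap, reassoc_of% ι_restrColimMap, ι_restrColimMap]

/-- The inclusion of a term of the diagram in the colimit over a stage of the filtration. -/
noncomputable def filtrationι (j : J) (x : T) (hx : x ∈ S j) :
    G.obj x ⟶ (filtrationColim G S hS).obj j :=
  colimit.ι (restr G (S j)) ⟨x, hx⟩

/-- The universal property of a stage of the filtration. -/
noncomputable def filtrationDesc (j : J) {A : D} (φ : ∀ x ∈ S j, G.obj x ⟶ A)
    (hφ : ∀ x y (h : x ≤ y) (hx : x ∈ S j) (hy : y ∈ S j), G.map (homOfLE h) ≫ φ y hy = φ x hx) :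
    (filtrationColim G S hS).obj j ⟶ A :=
  colimit.desc (restr G (S j)) (restrCocone G _ φ hφ)

lemma filtrationι_desc (j : J) {A : D} (φ : ∀ x ∈ S j, G.obj x ⟶ A)
    (hφ : ∀ x y (h : x ≤ y) (hx : x ∈ S j) (hy : y ∈ S j), G.map (homOfLE h) ≫ φ y hy = φ x hx)
    (x : T) (hx : x ∈ S j) :
    filtrationι G S hS j x hx ≫ filtrationDesc G S hS j φ hφ = φ x hx :=
  colimit.ι_desc (restrCocone G _ φ hφ) (⟨x, hx⟩ : S j)

lemma filtrationι_map {i j : J} (f : i ⟶ j) (x : T) (hx : x ∈ S i) :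
    filtrationι G S hS i x hx ≫ (filtrationColim G S hS).map f =
      filtrationι G S hS j x (hS (leOfHom f) hx) :=
  ι_restrColimMap G _ x hx

lemma filtrationι_map_assoc {i j : J} (f : i ⟶ j) (x : T) (hx : x ∈ S i) {A : D}
    (g : (filtrationColim G S hS).obj j ⟶ A) :
    filtrationι G S hS i x hx ≫ (filtrationColim G S hS).map f ≫ g =
      filtrationι G S hS j x (hS (leOfHom f) hx) ≫ g :=
  (reassoc_of% (filtrationι_map G S hS f x hx)) g

lemma map_filtrationι (j : J) {x y : T} (h : x ≤ y) (hx : x ∈ S j) (hy : y ∈ S j) :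
    G.map (homOfLE h) ≫ filtrationι G S hS j y hy = filtrationι G S hS j x hx :=
  restr_w (colimit.cocone (restr G (S j))) h _ _

lemma map_filtrationι_assoc (j : J) {x y : T} (h : x ≤ y) (hx : x ∈ S j) (hy : y ∈ S j) {A : D}
    (g : (filtrationColim G S hS).obj j ⟶ A) :
    G.map (homOfLE h) ≫ filtrationι G S hS j y hy ≫ g = filtrationι G S hS j x hx ≫ g :=
  (reassoc_of% (map_filtrationι G S hS j h hx hy)) g

variable {G S hS} in
lemma filtration_hom_ext {j : J} {A : D} {f g : (filtrationColim G S hS).obj j ⟶ A}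
    (h : ∀ x (hx : x ∈ S j), filtrationι G S hS j x hx ≫ f = filtrationι G S hS j x hx ≫ g) :
    f = g :=
  colimit.hom_ext fun x => h x.1 x.2

lemma filtrationColim_isWellOrderContinuous
    (hlim : ∀ j, Order.IsSuccLimit j → ∀ x ∈ S j, ∃ i < j, x ∈ S i) :
    (filtrationColim G S hS).IsWellOrderContinuous where
  nonempty_isColimit m hm := by
    choose i hi hx using hlim m hm
    have key (s : Cocone ((Set.principalSegIio m).monotone.functor ⋙ filtrationColim G S hS))
        (x : T) (hxm : x ∈ S m) (j : Set.Iio m) (hxj : x ∈ S j.1) :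
        filtrationι G S hS j.1 x hxj ≫ s.ι.app j =
          filtrationι G S hS (i x hxm) x (hx x hxm) ≫ s.ι.app ⟨i x hxm, hi x hxm⟩ := by
      wlog h : j.1 ≤ i x hxm generalizing j
      · have h' : (⟨i x hxm, hi x hxm⟩ : Set.Iio m) ≤ j := le_of_not_ge h
        rw [← s.w (homOfLE h')]
        exact (filtrationι_map_assoc G S hS (homOfLE (le_of_not_ge h)) x (hx x hxm)
          (s.ι.app j)).symm
      · have h' : j ≤ (⟨i x hxm, hi x hxm⟩ : Set.Iio m) := h
        rw [← s.w (homOfLE h')]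
        exact filtrationι_map_assoc G S hS (homOfLE h) x hxj (s.ι.app ⟨i x hxm, hi x hxm⟩)
    refine ⟨{
      desc s := filtrationDesc G S hS m
        (fun x hxm => filtrationι G S hS _ x (hx x hxm) ≫ s.ι.app ⟨_, hi x hxm⟩) ?_
      fac s j := ?_
      uniq s f hf := ?_ }⟩
    · intro x y h hxm hym
      obtain ⟨j, hj, hxj, hyj⟩ : ∃ j < m, x ∈ S j ∧ y ∈ S j := by
        obtain h | h := le_total (i x hxm) (i y hym)
        · exact ⟨_, hi y hym, hS h (hx x hxm), hx y hym⟩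
        · exact ⟨_, hi x hxm, hx x hxm, hS h (hx y hym)⟩
      rw [← key s x hxm ⟨j, hj⟩ hxj, ← key s y hym ⟨j, hj⟩ hyj]
      exact map_filtrationι_assoc G S hS j h hxj hyj _
    · refine filtration_hom_ext (hS := hS) fun x hxj => ?_
      refine (filtrationι_map_assoc G S hS (homOfLE (Set.mem_Iio.1 j.2).le) x hxj _).trans ?_
      exact (filtrationι_desc G S hS m _ _ x _).trans (key s x _ j hxj).symm
    · refine filtration_hom_ext (hS := hS) fun x hxm => ?_
      refine Eq.trans ?_ (filtrationι_desc G S hS m _ _ x hxm).symm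
      rw [← hf]
      exact (filtrationι_map_assoc G S hS (homOfLE (hi x hxm).le) x (hx x hxm) f).symm

/-- Adding one element `x` to a stage of the filtration is a cobase change of the latching map
at `x`. -/
lemma filtrationColim_isPushout (hlow : ∀ j, IsLowerSet (S j)) {i j : J} (f : i ⟶ j) (x : T)
    (hxi : x ∉ S i) (hx : ∀ y < x, y ∈ S i) (hxj : S j = insert x (S i))
    {c : Cocone (restr G (Set.Iio x))} (hc : IsColimit c) :
    IsPushout
      (hc.desc (restrCocone G _ (fun y hy => filtrationι G S hS i y (hx y (Set.mem_Iio.1 hy)))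
        (fun _ _ h _ _ => map_filtrationι G S hS i h _ _)))
      (hc.desc (latchingCocone G x)) ((filtrationColim G S hS).map f)
      (filtrationι G S hS j x (hxj ▸ Set.mem_insert _ _)) := by
  classical
  refine ⟨⟨hc.hom_ext fun y => ?_⟩, ⟨PushoutCocone.IsColimit.mk _
    (fun s => filtrationDesc G S hS j (fun y hy => if h : y = x then eqToHom (by rw [h]) ≫ s.inr
      else filtrationι G S hS i y (((Set.ext_iff.1 hxj y).1 hy).resolve_left h) ≫ s.inl) ?_)
    (fun s => ?_) (fun s => ?_) (fun s m h₁ h₂ => ?_)⟩⟩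
  · rw [hc.fac_assoc, hc.fac_assoc]
    exact (filtrationι_map G S hS f y.1 _).trans (map_filtrationι G S hS j y.2.le _ _).symm
  · intro y z h hy hz
    by_cases hz' : z = x
    · subst hz'
      by_cases hy' : y = z
      · subst hy'
        simp
      · have hyz : y ∈ Set.Iio z := lt_of_le_of_ne h hy'
        rw [dif_pos rfl, dif_neg hy']
        have := hc.fac (restrCocone G _
          (fun y hy => filtrationι G S hS i y (hx y (Set.mem_Iio.1 hy)))
          (fun _ _ h _ _ => map_filtrationι G S hS i h _ _)) ⟨y, hyz⟩
        have h₁ := hc.fac (latchingCocone G z) ⟨y, hyz⟩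
        dsimp at this h₁
        rw [← this, Category.assoc, s.condition, reassoc_of% h₁]
        simp
    · have hzi := ((Set.ext_iff.1 hxj z).1 hz).resolve_left hz'
      have hy' : y ≠ x := fun e => hxi (hlow i (by rwa [← e]) hzi)
      rw [dif_neg hz', dif_neg hy', map_filtrationι_assoc]
  · refine filtration_hom_ext (hS := hS) fun y hy => ?_
    rw [filtrationι_map_assoc, filtrationι_desc, dif_neg (fun e : y = x => hxi (e ▸ hy))]
  · rw [filtrationι_desc, dif_pos rfl, eqToHom_refl, Category.id_comp]
  · refine filtration_hom_ext (hS := hS) fun y hy => ?_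
    rw [filtrationι_desc]
    split_ifs with h
    · subst h
      rw [eqToHom_refl, Category.id_comp, h₂]
    · rw [← h₁, filtrationι_map_assoc]

/-- A filtration adding one element at a time presents the map between the colimits over its
first and last stages as a transfinite composition of cobase changes of latching maps. -/
lemma transfiniteCompositionsOfShape_filtrationColim [OrderBot J] [OrderTop J] [SuccOrder J]
    [WellFoundedLT J] (hlim : ∀ j, Order.IsSuccLimit j → ∀ x ∈ S j, ∃ i < j, x ∈ S i)
    (hlow : ∀ j, IsLowerSet (S j)) (W : MorphismProperty D)
    (hsucc : ∀ j, ¬ IsMax j → ∃ x ∉ S j, (∀ y < x, y ∈ S j) ∧ S (Order.succ j) = insert x (S j) ∧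
      ∃ (c : Cocone (restr G (Set.Iio x))) (hc : IsColimit c), W (hc.desc (latchingCocone G x))) :
    W.pushouts.transfiniteCompositionsOfShape J
      ((filtrationColim G S hS).map (homOfLE (bot_le : (⊥ : J) ≤ ⊤))) :=
  ⟨{
      F := filtrationColim G S hS
      isoBot := Iso.refl _
      isWellOrderContinuous := filtrationColim_isWellOrderContinuous G S hS hlim
      incl := { app j := (filtrationColim G S hS).map (homOfLE le_top)
                naturality i j f := by
                  rw [← Functor.map_comp]
                  exact (Category.comp_id _).symm }
      isColimit := colimitOfDiagramTerminal isTerminalTop _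
      fac := Category.id_comp _
      map_mem j hj := by
        obtain ⟨x, hx, hlt, heq, c, hc, hW⟩ := hsucc j hj
        exact W.pushouts_mk
          (filtrationColim_isPushout G S hS hlow (homOfLE (Order.le_succ j)) x hx hlt heq hc) hW }⟩

end

variable {G} in
lemma exists_iso_colimit_restr {S S' : Set T} [HasColimit (restr G S)] (h : S = S')
    {c : Cocone (restr G S')} (hc : IsColimit c) :
    ∃ e : colimit (restr G S) ≅ c.pt, ∀ x hx hx',
      colimit.ι (restr G S) ⟨x, hx⟩ ≫ e.hom = c.ι.app ⟨x, hx'⟩ := by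
  subst h
  exact ⟨(colimit.isColimit _).coconePointUniqueUpToIso hc,
    fun x hx _ => (colimit.isColimit _).comp_coconePointUniqueUpToIso_hom hc ⟨x, hx⟩⟩

/-- The map between the colimits of a diagram over two nested lower sets of a well-founded partially
ordered set is a transfinite composition of cobase changes of the latching maps at the elements of
the difference: add these elements one by one, along a well-order extending the given order. -/
theorem transfiniteCompositions_of_latching [WellFoundedLT T] {S₀ S₁ : Set T} (h₀₁ : S₀ ⊆ S₁)
    (h₀ : IsLowerSet S₀) (h₁ : IsLowerSet S₁) (hcolim : ∀ S ⊆ S₁, HasColimit (restr G S))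
    (W : MorphismProperty D) (hW : ∀ x ∈ S₁, x ∉ S₀ →
      ∃ (c : Cocone (restr G (Set.Iio x))) (hc : IsColimit c), W (hc.desc (latchingCocone G x)))
    {c₀ : Cocone (restr G S₀)} (hc₀ : IsColimit c₀) {c₁ : Cocone (restr G S₁)} (hc₁ : IsColimit c₁)
    (m : c₀.pt ⟶ c₁.pt) (hm : ∀ x hx, c₀.ι.app ⟨x, hx⟩ ≫ m = c₁.ι.app ⟨x, h₀₁ hx⟩) :
    MorphismProperty.transfiniteCompositions.{w} W.pushouts m := by
  -- `K` is the set of elements to be added, well-ordered compatibly with the order of `T`; the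
  -- stage `j : WithTop K` of the filtration consists of `S₀` and all elements of `K` less than `j`
  let K := WellOrderExtension ↥(S₁ \ S₀)
  let e : K → T := fun k => (toWellOrderExtension.symm k).1
  have he₀ (k : K) : e k ∉ S₀ := (toWellOrderExtension.symm k).2.2
  have he₁ (k : K) : e k ∈ S₁ := (toWellOrderExtension.symm k).2.1
  have heinj : Function.Injective e :=
    Subtype.val_injective.comp toWellOrderExtension.symm.injective
  have helt {k l : K} (h : e k < e l) : k < l := by
    have := toWellOrderExtension_strictMono
      (show toWellOrderExtension.symm k < toWellOrderExtension.symm l from h)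
    simpa using this
  have hesurj (x : T) (hx₁ : x ∈ S₁) (hx₀ : x ∉ S₀) : ∃ k, e k = x :=
    ⟨toWellOrderExtension ⟨x, hx₁, hx₀⟩, by simp [e]⟩
  let J := WithTop K
  let _ : OrderBot J := WellFoundedLT.toOrderBot J
  let _ : SuccOrder J := SuccOrder.ofLinearWellFoundedLT J
  let S : J → Set T := fun j => {x | x ∈ S₀ ∨ ∃ k : K, (k : J) < j ∧ e k = x}
  have hS : ∀ ⦃i j⦄, i ≤ j → ∀ ⦃x⦄, x ∈ S i → x ∈ S j := by
    rintro i j h x (hx | ⟨k, hk, rfl⟩)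
    · exact Or.inl hx
    · exact Or.inr ⟨k, hk.trans_le h, rfl⟩
  have hS₁ (j : J) : S j ⊆ S₁ := by
    rintro x (hx | ⟨k, hk, rfl⟩)
    · exact h₀₁ hx
    · exact he₁ k
  have hbot : S ⊥ = S₀ := by
    ext x
    simp [S]
  have htop : S ⊤ = S₁ := by
    refine (hS₁ ⊤).antisymm fun x hx => ?_
    by_cases hx' : x ∈ S₀
    · exact Or.inl hx'
    · obtain ⟨k, rfl⟩ := hesurj x hx hx'
      exact Or.inr ⟨k, WithTop.coe_lt_top k, rfl⟩
  have hmem (k l : K) (h : e k ∈ S l) : k < l := by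
    obtain h | ⟨k', hk', h⟩ := h
    · exact (he₀ k h).elim
    · obtain rfl := heinj h
      exact WithTop.coe_lt_coe.1 hk'
  have hlt (k : K) (y : T) (hy : y < e k) : y ∈ S k := by
    by_cases hy' : y ∈ S₀
    · exact Or.inl hy'
    · obtain ⟨l, rfl⟩ := hesurj y (h₁ hy.le (he₁ k)) hy'
      exact Or.inr ⟨l, WithTop.coe_lt_coe.2 (helt hy), rfl⟩
  have hlow (j : J) : IsLowerSet (S j) := by
    rintro x y hy (hx | ⟨k, hk, rfl⟩)
    · exact Or.inl (h₀ hy hx)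
    · obtain rfl | h := hy.eq_or_lt
      · exact Or.inr ⟨k, hk, rfl⟩
      · exact hS hk.le (hlt k y h)
  have (j : J) : HasColimit (restr G (S j)) := hcolim _ (hS₁ j)
  have key := transfiniteCompositionsOfShape_filtrationColim G S hS ?_ hlow W ?_
  · obtain ⟨e₀, he₀⟩ := exists_iso_colimit_restr hbot hc₀
    obtain ⟨e₁, he₁⟩ := exists_iso_colimit_restr htop hc₁
    refine (MorphismProperty.transfiniteCompositionsOfShape_le_transfiniteCompositions _ J _
      ((MorphismProperty.arrow_mk_iso_iff _ (Arrow.isoMk e₀ e₁ ?_)).1 key))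
    refine filtration_hom_ext (hS := hS) fun x hx => ?_
    have hx₀ : x ∈ S₀ := hbot ▸ hx
    refine ((reassoc_of% (he₀ x hx hx₀)) _).trans ((hm x hx₀).trans ?_)
    exact ((filtrationι_map_assoc G S hS (homOfLE (bot_le : (⊥ : J) ≤ ⊤)) x hx e₁.hom).trans
      (he₁ x (hS bot_le hx) (h₀₁ hx₀))).symm
  · rintro j hj x (hx | ⟨k, hk, rfl⟩)
    · exact ⟨⊥, hj.bot_lt, Or.inl hx⟩
    · exact ⟨_, hj.succ_lt hk, Or.inr ⟨k, Order.lt_succ_of_not_isMax (not_isMax_of_lt hk), rfl⟩⟩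
  · intro j hj
    induction j using WithTop.recTopCoe with
    | top => exact (hj isMax_top).elim
    | coe k =>
      refine ⟨e k, fun h => lt_irrefl _ (hmem k k h), hlt k, ?_, hW _ (he₁ k) (he₀ k)⟩
      ext x
      constructor
      · rintro (hx | ⟨l, hl, rfl⟩)
        · exact Or.inr (Or.inl hx)
        · obtain h | h := ((Order.lt_succ_iff_of_not_isMax hj).1 hl).eq_or_lt
          · obtain rfl := WithTop.coe_injective h
            exact Or.inl rfl
          · exact Or.inr (Or.inr ⟨l, h, rfl⟩)
      · rintro (rfl | hx)
        · exact Or.inr ⟨k, Order.lt_succ_of_not_isMax hj, rfl⟩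
        · exact hS (Order.le_succ _) hx

end Filtration

/-! ### Cocell structures of maps with given relative matching maps -/

lemma pushouts_op_le {D : Type u} [Category.{v} D] (Q : MorphismProperty D) :
    Q.op.pushouts ≤ Q.pullbacks.op := by
  rintro _ _ q ⟨_, _, _, _, _, h, sq⟩
  exact ⟨_, _, _, _, _, h, sq.unop⟩

section Cylinder

/-- Two copies of a partially ordered set `I`, indexing the source and the target of a natural
transformation between `I`-indexed diagrams. -/
inductive Cylinder (I : Type w) : Type w
  /-- the copy indexing the source -/
  | src (t : I)
  /-- the copy indexing the target -/
  | tgt (t : I)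

namespace Cylinder

/-- The identification of `Cylinder I` with `I × {false < true}`. -/
def toProd {I : Type w} : Cylinder I → I × Bool
  | src t => (t, true)
  | tgt t => (t, false)

lemma toProd_injective {I : Type w} : Function.Injective (toProd (I := I)) := by
  rintro (_ | _) (_ | _) h <;> simp_all [toProd]

variable {I : Type w} [PartialOrder I]

/-- The order of `I × {false < true}`, so that `tgt t ≤ src t`. -/
instance : PartialOrder (Cylinder I) := PartialOrder.lift toProd toProd_injective

lemma src_le_src {s t : I} : src s ≤ src t ↔ s ≤ t :=
  Prod.mk_le_mk_iff_left

lemma tgt_le_tgt {s t : I} : tgt s ≤ tgt t ↔ s ≤ t :=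
  Prod.mk_le_mk_iff_left

lemma tgt_le_src {s t : I} : tgt s ≤ src t ↔ s ≤ t :=
  Prod.mk_le_mk.trans (and_iff_left (Bool.false_le _))

lemma not_src_le_tgt {s t : I} : ¬ src s ≤ tgt t := fun h =>
  (show ¬ true ≤ false by decide) h.2

lemma src_lt_src {s t : I} : src s < src t ↔ s < t :=
  Prod.mk_lt_mk_iff_left

lemma tgt_lt_src {s t : I} : tgt s < src t ↔ s ≤ t :=
  lt_iff_le_and_ne.trans ((and_iff_left (by simp)).trans tgt_le_src)

end Cylinder

open Cylinder

variable {I : Type w} [PartialOrder I] {C : Type*} [Category* C]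

/-- The terms of the diagram given by a natural transformation `p : X ⟶ Y`: `src t` is sent to
`X_t`, and `tgt t` is sent to `Y_t`. -/
abbrev cylinderObj (X Y : Iᵒᵖ ⥤ C) : Cylinder I → C
  | src t => X.obj (op t)
  | tgt t => Y.obj (op t)

/-- The transition maps of the diagram given by a natural transformation. -/
def cylinderMap {X Y : Iᵒᵖ ⥤ C} (p : X ⟶ Y) :
    ∀ {x y : Cylinder I}, x ≤ y → (cylinderObj X Y y ⟶ cylinderObj X Y x)
  | src _, src _, h => X.map (homOfLE (src_le_src.1 h)).op
  | tgt _, tgt _, h => Y.map (homOfLE (tgt_le_tgt.1 h)).op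
  | tgt s, src _, h => X.map (homOfLE (tgt_le_src.1 h)).op ≫ p.app (op s)
  | src _, tgt _, h => (not_src_le_tgt h).elim

/-- A natural transformation between `I`-indexed diagrams in `C`, composed with a functor `C ⥤ D`,
as a single diagram in `Dᵒᵖ`. -/
abbrev cylinder {X Y : Iᵒᵖ ⥤ C} (p : X ⟶ Y) {D : Type*} [Category* D] (F : C ⥤ D) :
    Cylinder I ⥤ Dᵒᵖ where
  obj x := op (F.obj (cylinderObj X Y x))
  map f := (F.map (cylinderMap p (leOfHom f))).op
  map_id := by
    rintro (t | t)
    · exact congrArg Quiver.Hom.op ((congrArg F.map (X.map_id _)).trans (F.map_id _))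
    · exact congrArg Quiver.Hom.op ((congrArg F.map (Y.map_id _)).trans (F.map_id _))
  map_comp := by
    intro x y z f g
    refine congrArg Quiver.Hom.op ((congrArg F.map ?_).trans (F.map_comp _ _))
    have hf := leOfHom f
    have hg := leOfHom g
    match x, y, z with
    | src _, src _, src _ =>
      exact X.map_comp (homOfLE (src_le_src.1 hg)).op (homOfLE (src_le_src.1 hf)).op
    | tgt _, tgt _, tgt _ =>
      exact Y.map_comp (homOfLE (tgt_le_tgt.1 hg)).op (homOfLE (tgt_le_tgt.1 hf)).op
    | tgt _, src _, src _ =>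
      exact ((X.map_comp (homOfLE (src_le_src.1 hg)).op (homOfLE (tgt_le_src.1 hf)).op) =≫ _).trans
        (Category.assoc _ _ _)
    | tgt _, tgt _, src _ =>
      refine Eq.trans ?_ (Category.assoc _ _ _).symm
      refine Eq.trans ?_ (X.map (homOfLE (tgt_le_src.1 hg)).op ≫=
        p.naturality (homOfLE (tgt_le_tgt.1 hf)).op)
      exact ((X.map_comp (homOfLE (tgt_le_src.1 hg)).op (homOfLE (tgt_le_tgt.1 hf)).op) =≫ _).trans
        (Category.assoc _ _ _)
    | src _, tgt _, _ => exact (not_src_le_tgt hf).elim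
    | _, src _, tgt _ => exact (not_src_le_tgt hg).elim

variable [IsCofiniteDirected I]

instance : WellFoundedLT I :=
  StrictMono.wellFoundedLT (f := height) fun _ _ => height_lt

instance : WellFoundedLT (Cylinder I) :=
  ⟨InvImage.wf toProd (wellFounded_lt (α := I × Bool))⟩

variable {C : Type u} [Category.{v} C] [HasFiniteLimits C]

/-- The projections from the target of the relative matching map at `t` to the terms of the diagram
given by `p : X ⟶ Y` at all elements smaller than `src t`. -/
noncomputable def cylinderProj {X Y : Iᵒᵖ ⥤ C} (p : X ⟶ Y) (t : I) :
    ∀ x : Cylinder I, x < src t →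
      (pullback (matchingMap p t) (toMatching Y t) ⟶ cylinderObj X Y x)
  | src s, h => pullback.fst _ _ ≫ limit.π (below X t) (op ⟨s, src_lt_src.1 h⟩)
  | tgt _, h => pullback.snd _ _ ≫ Y.map (homOfLE (tgt_lt_src.1 h)).op

lemma cylinderProj_map {X Y : Iᵒᵖ ⥤ C} (p : X ⟶ Y) (t : I) {x y : Cylinder I} (h : x ≤ y)
    (hx : x < src t) (hy : y < src t) :
    cylinderProj p t y hy ≫ cylinderMap p h = cylinderProj p t x hx :=
  match x, y with
  | src x, src y => by
    have := limit_π_below_map X (src_lt_src.1 hy) (src_le_src.1 h)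
    exact (Category.assoc _ _ _).trans (_ ≫= this)
  | tgt x, tgt y =>
    (Category.assoc _ _ _).trans (_ ≫= (Y.map_comp (homOfLE (tgt_lt_src.1 hy)).op
      (homOfLE (tgt_le_tgt.1 h)).op).symm)
  | tgt x, src y => by
    have hyt := src_lt_src.1 hy
    have hxy := tgt_le_src.1 h
    have h₁ := limit_π_below_map X hyt hxy
    have h₂ := matchingMap_π_mk p (lt_of_le_of_lt hxy hyt)
    have h₃ := toMatching_π_mk Y (lt_of_le_of_lt hxy hyt)
    change (pullback.fst _ _ ≫ limit.π (below X t) (op ⟨y, hyt⟩)) ≫ X.map (homOfLE hxy).op ≫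
      p.app (op x) = pullback.snd _ _ ≫ Y.map (homOfLE (tgt_lt_src.1 hx)).op
    rw [Category.assoc, reassoc_of% h₁, ← h₂, pullback.condition_assoc, h₃]
  | src _, tgt _ => (not_src_le_tgt h).elim

lemma relMatchingMap_cylinderProj {X Y : Iᵒᵖ ⥤ C} (p : X ⟶ Y) (t : I) (x : Cylinder I)
    (hx : x < src t) :
    relMatchingMap p t ≫ cylinderProj p t x hx = cylinderMap p hx.le :=
  match x with
  | src x => by
    have h₁ := toMatching_π_mk X (src_lt_src.1 hx)
    exact ((reassoc_of% (relMatchingMap_fst p t)) _).trans h₁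
  | tgt x =>
    ((reassoc_of% (relMatchingMap_snd p t)) _).trans (p.naturality _).symm

variable {D : Type*} [Category* D] {X Y : Iᵒᵖ ⥤ C} (p : X ⟶ Y) (F : C ⥤ D)
  [PreservesFiniteLimits F] (t : I)

variable {p F t} in
lemma cylinderProj_hom_ext {A : D}
    {f g : A ⟶ F.obj (pullback (matchingMap p t) (toMatching Y t))}
    (h : ∀ x hx, f ≫ F.map (cylinderProj p t x hx) = g ≫ F.map (cylinderProj p t x hx)) :
    f = g := by
  let _ : Fintype (Set.Iio t) := Fintype.ofFinite _
  have hP := (IsPullback.of_hasPullback (matchingMap p t) (toMatching Y t)).map F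
  have hX := isLimitOfPreserves F (limit.isLimit (below X t))
  refine hP.hom_ext (hX.hom_ext fun s => ?_) ?_
  · have := h (src s.unop.1) (src_lt_src.2 s.unop.2)
    dsimp only [cylinderProj] at this
    rw [F.map_comp, ← Category.assoc, ← Category.assoc] at this
    exact this
  · have := h (tgt t) (tgt_lt_src.2 le_rfl)
    dsimp only [cylinderProj] at this
    have h' : Y.map (homOfLE (le_refl t)).op = 𝟙 _ := Y.map_id _
    rw [h', Category.comp_id] at this
    exact this

lemma exists_cylinderProj_lift {A : D} (φ : ∀ x < src t, A ⟶ F.obj (cylinderObj X Y x))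
    (hφ : ∀ x y (h : x ≤ y) (hx : x < src t) (hy : y < src t),
      φ y hy ≫ F.map (cylinderMap p h) = φ x hx) :
    ∃ l : A ⟶ F.obj (pullback (matchingMap p t) (toMatching Y t)),
      ∀ x hx, l ≫ F.map (cylinderProj p t x hx) = φ x hx := by
  let _ : Fintype (Set.Iio t) := Fintype.ofFinite _
  have hP := (IsPullback.of_hasPullback (matchingMap p t) (toMatching Y t)).map F
  have hX := isLimitOfPreserves F (limit.isLimit (below X t))
  have hY := isLimitOfPreserves F (limit.isLimit (below Y t))
  let c : Cone (below X t ⋙ F) :=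
    { pt := A
      π := { app s := φ (src s.unop.1) (src_lt_src.2 s.unop.2)
             naturality s r g := (Category.id_comp _).trans
              (hφ (src r.unop.1) (src s.unop.1) (src_le_src.2 (leOfHom g.unop)) _ _).symm } }
  have hc (s : I) (hs : s < t) : hX.lift c ≫ F.map (limit.π (below X t) (op ⟨s, hs⟩)) =
      φ (src s) (src_lt_src.2 hs) := hX.fac c (op ⟨s, hs⟩)
  have hsq : hX.lift c ≫ F.map (matchingMap p t) =
      φ (tgt t) (tgt_lt_src.2 le_rfl) ≫ F.map (toMatching Y t) := by
    refine hY.hom_ext fun ⟨s, (hs : s < t)⟩ => ?_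
    have h₁ := matchingMap_π_mk p hs
    have h₂ := toMatching_π_mk Y hs
    have h₃ := hφ (tgt s) (src s) (tgt_le_src.2 le_rfl) (tgt_lt_src.2 (le_of_lt hs))
      (src_lt_src.2 hs)
    have h₄ := hφ (tgt s) (tgt t) (tgt_le_tgt.2 (le_of_lt hs)) (tgt_lt_src.2 (le_of_lt hs))
      (tgt_lt_src.2 le_rfl)
    dsimp only [cylinderMap] at h₃ h₄
    have h₅ : X.map (homOfLE (le_refl s)).op = 𝟙 _ := X.map_id _
    rw [h₅, Category.id_comp] at h₃
    dsimp only [Functor.mapCone_π_app, limit.cone_π]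
    rw [Category.assoc, Category.assoc, ← F.map_comp, ← F.map_comp, h₁, h₂, F.map_comp,
      reassoc_of% (hc s hs), h₃, h₄]
  refine ⟨hP.lift _ _ hsq, ?_⟩
  rintro (s | s) hs
  · dsimp only [cylinderProj]
    rw [F.map_comp, hP.lift_fst_assoc]
    exact hc s _
  · dsimp only [cylinderProj]
    rw [F.map_comp, hP.lift_snd_assoc]
    exact hφ (tgt s) (tgt t) (tgt_le_tgt.2 (tgt_lt_src.1 hs)) hs _

/-- The latching map at `src t` of the diagram given by a natural transformation `p` is the
opposite of the relative matching map of `p` at `t`, provided that the functor `F` preserves the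
finite limits defining the latter. -/
lemma exists_isColimit_latching (Q : MorphismProperty D) (h : Q (F.map (relMatchingMap p t))) :
    ∃ (c : Cocone (restr (cylinder p F) (Set.Iio (src t)))) (hc : IsColimit c),
      Q.op (hc.desc (latchingCocone (cylinder p F) _)) := by
  let c : Cocone (restr (cylinder p F) (Set.Iio (src t))) :=
    restrCocone _ _ (A := op (F.obj (pullback (matchingMap p t) (toMatching Y t))))
      (fun x hx => (F.map (cylinderProj p t x hx)).op)
      (fun x y h hx hy => congrArg Quiver.Hom.op ((F.map_comp _ _).symm.trans
        (congrArg F.map (cylinderProj_map p t h hx hy))))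
  have hlift (s : Cocone (restr (cylinder p F) (Set.Iio (src t)))) :=
    exists_cylinderProj_lift p F t (A := s.pt.unop) (fun x hx => (s.ι.app ⟨x, hx⟩).unop)
      (fun x y h hx hy => congrArg Quiver.Hom.unop (restr_w s h hx hy))
  let hc : IsColimit c :=
    { desc s := (hlift s).choose.op
      fac s x := Quiver.Hom.unop_inj ((hlift s).choose_spec x.1 x.2)
      uniq s m hm := Quiver.Hom.unop_inj (cylinderProj_hom_ext fun x hx =>
        (congrArg Quiver.Hom.unop (hm ⟨x, hx⟩)).trans ((hlift s).choose_spec x hx).symm) }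
  refine ⟨c, hc, ?_⟩
  have : hc.desc (latchingCocone (cylinder p F) (src t)) = (F.map (relMatchingMap p t)).op :=
    hc.hom_ext fun x => (hc.fac _ x).trans (congrArg Quiver.Hom.op
      ((congrArg F.map (relMatchingMap_cylinderProj p t x.1 x.2).symm).trans (F.map_comp _ _)))
  rw [this]
  exact h

end Cylinder

section

open Cylinder

variable {I : Type w} [PartialOrder I] [IsCofiniteDirected I]

/-- The map between the limits of two diagrams is a cocell complex of relative matching maps. -/
lemma cocellComplexes_of_isLimit {C : Type u} [Category.{v} C] [HasFiniteLimits C]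
    {X Y : Iᵒᵖ ⥤ C} (p : X ⟶ Y) {D : Type u'} [Category.{v'} D] [HasLimitsOfSize.{w, w} D]
    (F : C ⥤ D) [PreservesFiniteLimits F] (Q : MorphismProperty D)
    (h : ∀ t, Q (F.map (relMatchingMap p t)))
    {c : Cone (X ⋙ F)} (hc : IsLimit c) {d : Cone (Y ⋙ F)} (hd : IsLimit d) (f : c.pt ⟶ d.pt)
    (hf : ∀ s, f ≫ d.π.app s = c.π.app s ≫ F.map (p.app s)) :
    cocellComplexes.{w} Q f := by
  let S₀ : Set (Cylinder I) := Set.range tgt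
  have hS₀ (t : I) : src t ∉ S₀ := by
    rintro ⟨s, hs⟩
    cases hs
  have h₀ : IsLowerSet S₀ := by
    rintro _ (s | s) h ⟨t, rfl⟩
    · exact (not_src_le_tgt h).elim
    · exact ⟨s, rfl⟩
  let φ₀ : ∀ x ∈ S₀, (cylinder p F).obj x ⟶ op d.pt
    | tgt t, _ => (d.π.app (op t)).op
    | src t, h => (hS₀ t h).elim
  let φ₁ : ∀ x ∈ (Set.univ : Set (Cylinder I)), (cylinder p F).obj x ⟶ op c.pt
    | tgt t, _ => (f ≫ d.π.app (op t)).op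
    | src t, _ => (c.π.app (op t)).op
  let c₀ : Cocone (restr (cylinder p F) S₀) := restrCocone _ S₀ φ₀ (by
    rintro (s | s) (t | t) h hs ht
    · exact (hS₀ _ hs).elim
    · exact (hS₀ _ hs).elim
    · exact (hS₀ _ ht).elim
    · exact congrArg Quiver.Hom.op (d.w (homOfLE (tgt_le_tgt.1 h)).op))
  let c₁ : Cocone (restr (cylinder p F) Set.univ) := restrCocone _ _ φ₁ (by
    rintro (s | s) (t | t) h hs ht
    · exact congrArg Quiver.Hom.op (c.w (homOfLE (src_le_src.1 h)).op)
    · exact (not_src_le_tgt h).elim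
    · refine congrArg Quiver.Hom.op (Eq.trans ?_ (hf _).symm)
      refine (c.π.app _ ≫= F.map_comp _ _).trans ?_
      exact (Category.assoc _ _ _).symm.trans (c.w (homOfLE (tgt_le_src.1 h)).op =≫ _)
    · refine congrArg Quiver.Hom.op ((Category.assoc _ _ _).trans ?_)
      exact f ≫= d.w (homOfLE (tgt_le_tgt.1 h)).op)
  have hc₀ : IsColimit c₀ :=
    let cn (s : Cocone (restr (cylinder p F) S₀)) : Cone (Y ⋙ F) :=
      { pt := s.pt.unop
        π := { app t := (s.ι.app ⟨tgt t.unop, _, rfl⟩).unop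
               naturality t t' g := (Category.id_comp _).trans (congrArg Quiver.Hom.unop
                (restr_w s (tgt_le_tgt.2 (leOfHom g.unop)) ⟨_, rfl⟩ ⟨_, rfl⟩).symm) } }
    { desc s := (hd.lift (cn s)).op
      fac s := by
        rintro ⟨_, t, rfl⟩
        exact congrArg Quiver.Hom.op (hd.fac (cn s) (op t))
      uniq s m hm := Quiver.Hom.unop_inj (hd.uniq (cn s) m.unop fun t =>
        congrArg Quiver.Hom.unop (hm ⟨_, t.unop, rfl⟩)) }
  have hc₁ : IsColimit c₁ :=
    let cn (s : Cocone (restr (cylinder p F) Set.univ)) : Cone (X ⋙ F) :=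
      { pt := s.pt.unop
        π := { app t := (s.ι.app ⟨src t.unop, trivial⟩).unop
               naturality t t' g := (Category.id_comp _).trans (congrArg Quiver.Hom.unop
                (restr_w s (src_le_src.2 (leOfHom g.unop)) trivial trivial).symm) } }
    { desc s := (hc.lift (cn s)).op
      fac s := by
        rintro ⟨(t | t), ht⟩
        · exact congrArg Quiver.Hom.op (hc.fac (cn s) (op t))
        · have h₁ := restr_w s (tgt_le_src.2 (le_refl t)) trivial trivial
          have h₂ := restr_w c₁ (tgt_le_src.2 (le_refl t)) trivial trivial
          rw [← h₁, ← h₂, Category.assoc]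
          exact _ ≫= congrArg Quiver.Hom.op (hc.fac (cn s) (op t))
      uniq s m hm := Quiver.Hom.unop_inj (hc.uniq (cn s) m.unop fun t =>
        congrArg Quiver.Hom.unop (hm ⟨src t.unop, trivial⟩)) }
  have key := transfiniteCompositions_of_latching (cylinder p F) (Set.subset_univ S₀) h₀
    isLowerSet_univ (fun S _ => inferInstance) Q.op ?_ hc₀ hc₁ f.op ?_
  · exact MorphismProperty.transfiniteCompositions_monotone (pushouts_op_le Q) _ key
  · rintro (t | t) _ ht
    · exact exists_isColimit_latching p F t Q (h t)
    · exact (ht ⟨t, rfl⟩).elim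
  · rintro _ ⟨t, rfl⟩
    rfl

/-- Special maps are limits in `Pro C` of levelwise maps of constant pro-objects, and passing to
constant pro-objects preserves the finite limits in the definition of relative matching maps. -/
lemma special_le_cocellComplexes {C : Type u} [Category.{v} C] [HasFiniteLimits C]
    (P : MorphismProperty C) :
    special P ≤ cocellComplexes.{v} (P.strictMap (Pro.const C)) := by
  rintro A B f ⟨I, _, _, r, hr⟩
  exact cocellComplexes_of_isLimit r.map (Pro.const C) _ (fun t => ⟨hr t⟩) r.isLimitSrcCone
    r.isLimitTgtCone f r.comp_tgtCone_π

/-- Each component of a natural transformation is a cocell complex of relative matching maps. -/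
lemma cocellComplexes_app {C : Type u} [Category.{v} C] [HasFiniteLimits C]
    {X Y : Iᵒᵖ ⥤ C} (p : X ⟶ Y) (P : MorphismProperty C)
    (h : ∀ t, P (relMatchingMap p t)) (t : I) :
    cocellComplexes.{w} P (p.app (op t)) := by
  -- the colimits over `Iic (tgt t)` and `Iic (src t)` are the values at the greatest elements, and
  -- all subsets of `Iic (src t)` are finite, so that finite limits in `C` suffice
  let x₀ : ↥(Set.Iic (tgt t)) := ⟨tgt t, Set.self_mem_Iic⟩
  let x₁ : ↥(Set.Iic (src t)) := ⟨src t, Set.self_mem_Iic⟩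
  have hx₀ : IsTerminal x₀ := IsTerminal.ofUniqueHom (fun y => homOfLE y.2) (fun _ _ => rfl)
  have hx₁ : IsTerminal x₁ := IsTerminal.ofUniqueHom (fun y => homOfLE y.2) (fun _ _ => rfl)
  have hfin : (Set.Iic (src t)).Finite := by
    have ht := IsCofiniteDirected.finite_le t
    refine ((ht.image src).union (ht.image tgt)).subset ?_
    rintro (s | s) hs
    · exact Or.inl ⟨s, src_le_src.1 hs, rfl⟩
    · exact Or.inr ⟨s, tgt_le_src.1 hs, rfl⟩
  have key := transfiniteCompositions_of_latching (cylinder p (𝟭 C))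
    (Set.Iic_subset_Iic.2 (tgt_le_src.2 (le_refl t))) (isLowerSet_Iic _) (isLowerSet_Iic _)
    (fun S hS => by
      have := (hfin.subset hS).to_subtype
      let _ : Fintype S := Fintype.ofFinite _
      infer_instance) P.op ?_ (colimitOfDiagramTerminal hx₀ _)
      (colimitOfDiagramTerminal hx₁ _) (p.app (op t)).op ?_
  · exact MorphismProperty.transfiniteCompositions_monotone (pushouts_op_le P) _ key
  · rintro (s | s) hs hs'
    · exact exists_isColimit_latching p (𝟭 C) s P (h s)
    · exact (hs' (tgt_le_tgt.2 (tgt_le_src.1 hs))).elim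
  · rintro (s | s) hs
    · exact (not_src_le_tgt hs).elim
    · exact congrArg Quiver.Hom.op (p.naturality _).symm

end

/-! ### Retracts of essentially levelwise maps -/

section Retracts

variable {C : Type u} [Category.{v} C]

/-- The maps from a map `f` of pro-objects to constant maps of pro-objects. Their targets form a
large cofiltered diagram of which `f` is the limit. -/
abbrev ConstUnder {A B : Pro C} (f : A ⟶ B) :=
  StructuredArrow (Arrow.mk f) (Pro.const C).mapArrow

namespace LevelRep

variable {A B : Pro C} {f : A ⟶ B} {I : Type v} [SmallCategory I] [IsCofiltered I]
  (r : LevelRep I f)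

/-- The functor sending an index to the projection to the corresponding term of a level
representation. -/
noncomputable abbrev toConstUnder : I ⥤ ConstUnder f where
  obj s := StructuredArrow.mk (Y := Arrow.mk (r.map.app s))
    (Arrow.homMk (r.srcCone.π.app s) (r.tgtCone.π.app s) (r.comp_tgtCone_π s).symm)
  map {s t} a := StructuredArrow.homMk
    (Arrow.homMk (r.src.map a) (r.tgt.map a) (r.map.naturality a)) (by
      ext
      · exact r.srcCone.w a
      · exact r.tgtCone.w a)

/-- This is the description of maps to constant pro-objects as a filtered colimit. -/
instance : r.toConstUnder.Initial := by
  refine Functor.initial_of_exists_of_isCofiltered _ (fun κ => ?_) (fun {κ s} a b => ?_)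
  · obtain ⟨t, u, v, w, hu, hv⟩ := r.exists_factor κ.right.hom κ.hom.left κ.hom.right κ.hom.w
    exact ⟨t, ⟨StructuredArrow.homMk (Arrow.homMk u v w) (by
      ext
      · exact hu
      · exact hv)⟩⟩
  · have hab : (r.toConstUnder.obj s).hom ≫ (Pro.const C).mapArrow.map a.right =
        (r.toConstUnder.obj s).hom ≫ (Pro.const C).mapArrow.map b.right :=
      (StructuredArrow.w a).trans (StructuredArrow.w b).symm
    obtain ⟨t₁, c₁, h₁⟩ := Pro.exists_map_comp_eq r.isLimitSrcCone (s := s)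
      ((Pro.const C).map a.right.left) ((Pro.const C).map b.right.left)
      (congrArg CommaMorphism.left hab)
    obtain ⟨t₂, c₂, h₂⟩ := Pro.exists_map_comp_eq r.isLimitTgtCone (s := s)
      ((Pro.const C).map a.right.right) ((Pro.const C).map b.right.right)
      (congrArg CommaMorphism.right hab)
    obtain ⟨t, d₁, d₂, hd⟩ := IsCofiltered.cospan c₁ c₂
    refine ⟨t, d₁ ≫ c₁, ?_⟩
    have h₁' : r.src.map c₁ ≫ a.right.left = r.src.map c₁ ≫ b.right.left :=
      (Pro.const C).map_injective (by rw [Functor.map_comp, Functor.map_comp]; exact h₁)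
    have h₂' : r.tgt.map c₂ ≫ a.right.right = r.tgt.map c₂ ≫ b.right.right :=
      (Pro.const C).map_injective (by rw [Functor.map_comp, Functor.map_comp]; exact h₂)
    ext
    · change r.src.map (d₁ ≫ c₁) ≫ a.right.left = r.src.map (d₁ ≫ c₁) ≫ b.right.left
      rw [Functor.map_comp, Category.assoc, Category.assoc, h₁']
    · change r.tgt.map (d₁ ≫ c₁) ≫ a.right.right = r.tgt.map (d₁ ≫ c₁) ≫ b.right.right
      rw [hd, Functor.map_comp, Category.assoc, Category.assoc, h₂']

end LevelRep

namespace ConstUnder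

variable {A B : Pro C} (f : A ⟶ B)

/-- The tautological cone with point the source of a map over its canonical diagram. -/
noncomputable abbrev leftCone :
    Cone (StructuredArrow.proj (Arrow.mk f) (Pro.const C).mapArrow ⋙ Arrow.leftFunc ⋙
      Pro.const C) where
  pt := A
  π := { app κ := κ.hom.left
         naturality _ _ a := (Category.id_comp _).trans
           (congrArg CommaMorphism.left (StructuredArrow.w a)).symm }

/-- The tautological cone with point the target of a map over its canonical diagram. -/
noncomputable abbrev rightCone :
    Cone (StructuredArrow.proj (Arrow.mk f) (Pro.const C).mapArrow ⋙ Arrow.rightFunc ⋙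
      Pro.const C) where
  pt := B
  π := { app κ := κ.hom.right
         naturality _ _ a := (Category.id_comp _).trans
           (congrArg CommaMorphism.right (StructuredArrow.w a)).symm }

end ConstUnder

variable {A B : Pro C} {f : A ⟶ B} {P : MorphismProperty C}

/-- A map of pro-objects belongs to `P` essentially levelwise if and only if the constant maps
belonging to `P` are cofinal among all constant maps under it. -/
lemma essentiallyLevelwise_iff_forall_constUnder :
    essentiallyLevelwise P f ↔
      ∀ κ : ConstUnder f, ∃ κ' : ConstUnder f, P κ'.right.hom ∧ Nonempty (κ' ⟶ κ) := by
  constructor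
  · rintro ⟨I, _, _, r, hr⟩ κ
    obtain ⟨x⟩ := (Functor.Initial.out (F := r.toConstUnder) κ).is_nonempty
    exact ⟨r.toConstUnder.obj x.left, hr _, ⟨x.hom⟩⟩
  · intro h
    obtain ⟨I, _, _, ⟨r⟩⟩ := exists_levelRep f
    have : IsCofiltered (ConstUnder f) := IsCofiltered.of_initial r.toConstUnder
    -- the constant maps in `P` under `f` form a full subcategory `Q` of the cofiltered category
    -- `ConstUnder f`, which is cofiltered with initial inclusion; a small cofiltered category with
    -- an initial functor to it indexes the level representation
    let Q : ObjectProperty (ConstUnder f) := fun κ => P κ.right.hom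
    have hQ (κ : ConstUnder f) : ∃ κ', Nonempty (Q.ι.obj κ' ⟶ κ) := by
      obtain ⟨κ', h', ⟨a⟩⟩ := h κ
      exact ⟨⟨κ', h'⟩, ⟨a⟩⟩
    have : IsCofiltered Q.FullSubcategory :=
      IsCofiltered.of_exists_of_isCofiltered_of_fullyFaithful Q.ι hQ
    have : Q.ι.Initial := Functor.initial_of_exists_of_isCofiltered_of_fullyFaithful Q.ι hQ
    have : InitiallySmall.{v} Q.FullSubcategory := by
      choose κ' a using hQ
      refine initiallySmall_of_small_weakly_initial_set
        (Set.range fun s : I => κ' (r.toConstUnder.obj s)) fun κ => ?_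
      obtain ⟨x⟩ := (Functor.Initial.out (F := r.toConstUnder) κ.obj).is_nonempty
      exact ⟨_, ⟨x.left, rfl⟩, ⟨Q.ι.preimage ((a _).some ≫ x.hom)⟩⟩
    obtain ⟨J, _, _, G, _⟩ := InitiallySmall.exists_of_isCofiltered.{v} Q.FullSubcategory
    let H : J ⥤ ConstUnder f := G ⋙ Q.ι
    have hl : IsLimit (ConstUnder.leftCone f) :=
      Functor.Initial.isLimitWhiskerEquiv r.toConstUnder _ r.isLimitSrcCone
    have hr : IsLimit (ConstUnder.rightCone f) :=
      Functor.Initial.isLimitWhiskerEquiv r.toConstUnder _ r.isLimitTgtCone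
    refine ⟨J, inferInstance, inferInstance, Pro.levelRepOfIsLimit
      (X := H ⋙ StructuredArrow.proj _ _ ⋙ Arrow.leftFunc)
      (Y := H ⋙ StructuredArrow.proj _ _ ⋙ Arrow.rightFunc)
      { app j := (H.obj j).right.hom
        naturality i j a := (H.map a).right.w }
      ((Functor.Initial.isLimitWhiskerEquiv H _).symm hl)
      ((Functor.Initial.isLimitWhiskerEquiv H _).symm hr) f
      (fun j => (H.obj j).hom.w.symm), fun j => (G.obj j).property⟩

instance : (essentiallyLevelwise P).IsStableUnderRetracts where
  of_retract {A B A' B' f g} h hg := by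
    rw [essentiallyLevelwise_iff_forall_constUnder] at hg ⊢
    intro κ
    obtain ⟨κ', h', ⟨a⟩⟩ := hg (StructuredArrow.mk (h.r ≫ κ.hom))
    refine ⟨StructuredArrow.mk (h.i ≫ κ'.hom), h', ⟨StructuredArrow.homMk a.right ?_⟩⟩
    have ha : κ'.hom ≫ (Pro.const C).mapArrow.map a.right = h.r ≫ κ.hom := StructuredArrow.w a
    change (h.i ≫ κ'.hom) ≫ (Pro.const C).mapArrow.map a.right = κ.hom
    rw [Category.assoc, ha, h.retract_assoc]

end Retracts

/-! ### Strict fibrations and cocell complexes -/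

section Strict

variable {C : Type u} [Category.{v} C]

/-- A levelwise factorization of a level representation yields a factorization of the map of
pro-objects which it represents. -/
lemma LevelRep.exists_fac [HasFiniteLimits C] {I : Type v} [PartialOrder I] [IsCofiniteDirected I]
    {A B : Pro C} {f : A ⟶ B} (r : LevelRep Iᵒᵖ f) {Z : Iᵒᵖ ⥤ C} {j : r.src ⟶ Z} {p : Z ⟶ r.tgt}
    (fac : j ≫ p = r.map) :
    ∃ (E : Pro C) (i : A ⟶ E) (q : E ⟶ B), i ≫ q = f ∧
      (∀ P : MorphismProperty C, (∀ s, P (j.app s)) → essentiallyLevelwise P i) ∧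
      (∀ P : MorphismProperty C, (∀ s, P (p.app s)) → essentiallyLevelwise P q) ∧
      ∀ P : MorphismProperty C, (∀ t, P (relMatchingMap p t)) → special P q := by
  let i : A ⟶ (Pro.ofDiagram Iᵒᵖ).obj Z := r.iso.hom.left ≫ (Pro.ofDiagram Iᵒᵖ).map j
  let q : (Pro.ofDiagram Iᵒᵖ).obj Z ⟶ B := (Pro.ofDiagram Iᵒᵖ).map p ≫ r.iso.inv.right
  let ri : LevelRep Iᵒᵖ i := Pro.levelRepOfIsLimit j r.isLimitSrcCone (Pro.isLimitCone Z) i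
    (fun s => by
      change (r.iso.hom.left ≫ _) ≫ Pro.π Z s = (r.iso.hom.left ≫ Pro.π r.src s) ≫ _
      rw [Category.assoc, Pro.ofDiagram_map_π, Category.assoc])
  have hinv : r.iso.inv.right ≫ r.iso.hom.right = 𝟙 _ :=
    congrArg CommaMorphism.right r.iso.inv_hom_id
  let rq : LevelRep Iᵒᵖ q := Pro.levelRepOfIsLimit p (Pro.isLimitCone Z) r.isLimitTgtCone q
    (fun s => by
      change (_ ≫ r.iso.inv.right) ≫ r.iso.hom.right ≫ Pro.π r.tgt s = Pro.π Z s ≫ _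
      rw [Category.assoc, reassoc_of% hinv, Pro.ofDiagram_map_π])
  refine ⟨_, i, q, ?_, fun P hP => ⟨_, _, _, ri, hP⟩, fun P hP => ⟨_, _, _, rq, hP⟩,
    fun P hP => ⟨I, _, _, rq, hP⟩⟩
  refine r.isLimitTgtCone.hom_ext fun s => ?_
  rw [Category.assoc, r.comp_tgtCone_π]
  change (r.iso.hom.left ≫ _) ≫ (_ ≫ r.iso.inv.right) ≫ r.iso.hom.right ≫ Pro.π r.tgt s =
    (r.iso.hom.left ≫ Pro.π r.src s) ≫ _
  rw [Category.assoc, Category.assoc, reassoc_of% hinv, ← Functor.map_comp_assoc, fac,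
    Pro.ofDiagram_map_π, Category.assoc]

/-- Every map of pro-objects has a level representation indexed by a cofinite directed set. -/
lemma exists_cofiniteDirected_levelRep {A B : Pro C} (f : A ⟶ B) :
    ∃ (I : Type v) (_ : PartialOrder I) (_ : IsCofiniteDirected I), Nonempty (LevelRep Iᵒᵖ f) := by
  obtain ⟨I, _, _, ⟨r⟩⟩ := exists_levelRep f
  obtain ⟨J, _, _, s, -⟩ :=
    essentiallyLevelwise.exists_cofiniteDirected (P := ⊤) ⟨I, _, _, r, fun _ => trivial⟩
  exact ⟨J, inferInstance, inferInstance, ⟨s⟩⟩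

lemma special_monotone [HasFiniteLimits C] {P Q : MorphismProperty C} (h : P ≤ Q) :
    special P ≤ special Q := by
  rintro A B f ⟨I, _, _, r, hr⟩
  exact ⟨I, _, _, r, fun t => h _ (hr t)⟩

lemma retracts_cocellComplexes_le {D : Type u} [Category.{v} D] (W : MorphismProperty D) :
    (cocellComplexes.{w} W).retracts ≤ W.llp.rlp :=
  MorphismProperty.retracts_le_iff.2 (cocellComplexes_le_rlp_llp W)

variable [ModelCategory C]

lemma strictFibrations_le_retracts_cocellComplexes :
    strictFibrations C ≤
      (cocellComplexes.{v} ((fibrations C).strictMap (Pro.const C))).retracts :=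
  MorphismProperty.retracts_monotone (special_le_cocellComplexes _)

/-- Trivial fibrations contain the cocell complexes of trivial fibrations, since they are defined by
a right lifting property. -/
lemma trivialFibrations_app_of_relMatchingMap {I : Type v} [PartialOrder I] [IsCofiniteDirected I]
    {X Y : Iᵒᵖ ⥤ C} {p : X ⟶ Y} (h : ∀ t, trivialFibrations C (relMatchingMap p t)) (s : Iᵒᵖ) :
    trivialFibrations C (p.app s) := by
  have := cocellComplexes_le_rlp_llp _ _ (cocellComplexes_app p _ h s.unop)
  rwa [trivialFibrations_llp, cofibrations_rlp] at this

/-- A map having the right lifting property against the levelwise trivial cofibrations is a strict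
fibration. -/
lemma strictFibrations_of_rlp {A B : Pro C} {f : A ⟶ B}
    (hf : (essentiallyLevelwise (trivialCofibrations C)).rlp f) : strictFibrations C f := by
  obtain ⟨I, _, _, ⟨r⟩⟩ := exists_cofiniteDirected_levelRep f
  obtain ⟨Z, j, p, fac, hj, hp⟩ := exists_levelwise_factorization
    (W₁ := trivialCofibrations C) (W₂ := fibrations C) r.map
  obtain ⟨E, i, q, rfl, hi, -, hq⟩ := r.exists_fac fac
  have := hf _ (hi _ hj)
  exact ⟨_, _, q, RetractArrow.ofRightLiftingProperty rfl, hq _ hp⟩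

/-- A map having the right lifting property against the levelwise cofibrations is a strict
acyclic fibration. -/
lemma strictAcyclicFibrations_of_rlp {A B : Pro C} {f : A ⟶ B}
    (hf : (essentiallyLevelwise (cofibrations C)).rlp f) : strictAcyclicFibrations C f := by
  obtain ⟨I, _, _, ⟨r⟩⟩ := exists_cofiniteDirected_levelRep f
  obtain ⟨Z, j, p, fac, hj, hp⟩ := exists_levelwise_factorization
    (W₁ := cofibrations C) (W₂ := trivialFibrations C) r.map
  obtain ⟨E, i, q, rfl, hi, hq', hq⟩ := r.exists_fac fac
  have := hf _ (hi _ hj)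
  have h : RetractArrow (i ≫ q) q := RetractArrow.ofRightLiftingProperty rfl
  exact ⟨⟨_, _, q, h, special_monotone (fun _ _ _ h => h.1) _ (hq _ hp)⟩,
    (essentiallyLevelwise (weakEquivalences C)).of_retract h
      (hq' _ fun s => (trivialFibrations_app_of_relMatchingMap hp s).2)⟩

/-- A strict acyclic fibration `f` lifts against the levelwise trivial cofibration in the
factorization of a levelwise weak equivalence representing `f`. -/
lemma strictAcyclicFibrations_le_retracts_cocellComplexes :
    strictAcyclicFibrations C ≤
      (cocellComplexes.{v} ((trivialFibrations C).strictMap (Pro.const C))).retracts := by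
  rintro A B f ⟨hf, hf'⟩
  obtain ⟨I, _, _, r, hr⟩ := essentiallyLevelwise.exists_cofiniteDirected hf'
  obtain ⟨Z, j, p, fac, hj, hp⟩ := exists_levelwise_factorization
    (W₁ := cofibrations C) (W₂ := trivialFibrations C) r.map
  obtain ⟨E, i, q, rfl, hi, -, hq⟩ := r.exists_fac fac
  -- `p` is a levelwise weak equivalence, hence so is `j`
  have hj' (s) : trivialCofibrations C (j.app s) := by
    refine ⟨hj s, (weakEquivalences C).of_postcomp _ (p.app s)
      (trivialFibrations_app_of_relMatchingMap hp s).2 ?_⟩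
    rw [← NatTrans.comp_app, fac]
    exact hr s
  have := retracts_cocellComplexes_le _ _ (strictFibrations_le_retracts_cocellComplexes _ hf) i
    (essentiallyLevelwise_le_llp (by rw [fibrations_llp]) _ (hi _ hj'))
  exact ⟨_, _, q, RetractArrow.ofRightLiftingProperty rfl, special_le_cocellComplexes _ _ (hq _ hp)⟩

end Strict

end StrictPro

theorem mainTheorem6 {C : Type u} [Category.{v} C] [ModelCategory C]
    [StrictPro.IsProperModelCategory C] :
    StrictPro.strictFibrations C =
      (StrictPro.cocellComplexes.{v}
        ((fibrations C).strictMap (StrictPro.Pro.const C))).retracts ∧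
    StrictPro.strictAcyclicFibrations C =
      (StrictPro.cocellComplexes.{v}
        ((trivialFibrations C).strictMap (StrictPro.Pro.const C))).retracts := by
  refine ⟨le_antisymm StrictPro.strictFibrations_le_retracts_cocellComplexes fun _ _ f hf => ?_,
    le_antisymm StrictPro.strictAcyclicFibrations_le_retracts_cocellComplexes fun _ _ f hf => ?_⟩
  · refine StrictPro.strictFibrations_of_rlp fun _ _ i hi => ?_
    exact StrictPro.retracts_cocellComplexes_le _ _ hf i
      (StrictPro.essentiallyLevelwise_le_llp (by rw [fibrations_llp]) _ hi)
  · refine StrictPro.strictAcyclicFibrations_of_rlp fun _ _ i hi => ?_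
    exact StrictPro.retracts_cocellComplexes_le _ _ hf i
      (StrictPro.essentiallyLevelwise_le_llp (by rw [trivialFibrations_llp]) _ hi)
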